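/- Let $d\ge 1$. Write $|\cdot|$ for the Euclidean norm and $B(x,r)=\{y\in\mathbb Z^d: |x-y|<r\}$. For $x\neq y$ in $\mathbb Z^d$ let $C_{xy}=C_{yx}\in[0,\infty)$, and put $C_{xx}=0$. Assume: (A1) There exist $c_1,c_2>0$ such that $c_1\le \nu_x:=\sum_{y\in\mathbb Z^d}C_{xy}\le c_2$ for all $x\in\mathbb Z^d$. (A2) $M_0\ge 1$ is a number for which there is $\delta>0$ such that for all $x,y\in\mathbb Z^d$ with $|x-y|=1$ there exist $N\ge 2$ and $x_1,\dots,x_N\in B(x,M_0)$ with $x_1=x$, $x_N=y$ and $C_{x_ix_{i+1}}\ge\delta$ for $i=1,\dots,N-1$. (A3) There exist a decreasing (that is, non-increasing) function $\varphi:\mathbb N\to[0,\infty)$ with $\sum_{i=1}^\infty i^{d+1}\varphi(i)<\infty$ and a constant $c>0$ with $\varphi(2i)\le c\,\varphi(i)$ for all $i\in\mathbb N$, such that $C_{xy}\le\varphi(\lfloor|x-y|\rfloor)$ for all $x,y\in\mathbb Z^d$. (A4) There exists a constant $c>0$ such that $C_{xy}\le c\,C_{xy'}$ for all $x,y,y'\in\mathbb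 Z^d$ with $|y-y'|\le|x-y|/3$. Let $X$ be the Markov chain on $\mathbb Z^d$ with $\mathbb P^x(X_1=y)=C_{xy}/\nu_x$. A bounded function $h:\mathbb Z^d\to\mathbb R$ is called harmonic on $A\subset\mathbb Z^d$ if $\sum_z h(z)\,\mathbb P^x(X_1=z)=h(x)$ for all $x\in A$. Then there exists a constant $c>0$, independent of $x_0$, $R$ and $h$, such that for every $x_0\in\mathbb Z^d$, every real $R>M_0$ and every nonnegative bounded function $h$ on $\mathbb Z^d$ which is harmonic on $B(x_0,2R)$, $$h(x)\le c\,h(y)\qquad\text{for all }x,y\in B(x_0,R).$$ -/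

import Mathlib

/-- The lattice `ℤ^d`. (Its default distance in Mathlib is the sup distance, which is not used.) -/
abbrev ZLat (d : ℕ) : Type := Fin d → ℤ

namespace ZLat

variable {d : ℕ}

/-- The Euclidean distance `|x - y|` of two lattice points. -/
noncomputable def eDist (x y : ZLat d) : ℝ :=
  ‖(WithLp.toLp 2 (fun i => ((x i - y i : ℤ) : ℝ)) : EuclideanSpace ℝ (Fin d))‖

/-- The open Euclidean ball `B(x, r) = {y ∈ ℤ^d : |x - y| < r}`. -/
def eBall (x : ZLat d) (r : ℝ) : Set (ZLat d) := {y | eDist x y < r}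

end ZLat

/-- Conductances on `ℤ^d`: nonnegative and symmetric. They are given only for distinct points;
this is encoded by the value `0` on the diagonal. -/
structure IsConductance {d : ℕ} (C : ZLat d → ZLat d → ℝ) : Prop where
  nonneg : ∀ x y, 0 ≤ C x y
  symm : ∀ x y, C x y = C y x
  diag : ∀ x, C x x = 0

namespace IsConductance

variable {d : ℕ} (C : ZLat d → ZLat d → ℝ)

/-- The total conductance `ν_x = ∑_y C_{xy}`. -/
noncomputable def nu (x : ZLat d) : ℝ := ∑' y, C x y

/-- (A1): the total conductances are finite and lie between two positive constants. -/
def A1 : Prop :=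
  ∃ c₁ c₂ : ℝ, 0 < c₁ ∧ 0 < c₂ ∧ ∀ x, Summable (C x) ∧ c₁ ≤ nu C x ∧ nu C x ≤ c₂

/-- (A2) for a given `M₀`: lattice neighbours `x, y` are joined by a path `x = x_1, …, x_N = y`
inside `B(x, M₀)` along which all conductances are at least some `δ > 0`, uniformly in `x, y`. -/
def A2 (M₀ : ℝ) : Prop :=
  1 ≤ M₀ ∧ ∃ δ : ℝ, 0 < δ ∧ ∀ x y : ZLat d, ZLat.eDist x y = 1 →
    ∃ (N : ℕ) (p : ℕ → ZLat d), 2 ≤ N ∧ p 1 = x ∧ p N = y ∧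
      (∀ i, 1 ≤ i → i ≤ N → p i ∈ ZLat.eBall x M₀) ∧
      (∀ i, 1 ≤ i → i < N → δ ≤ C (p i) (p (i + 1)))

/-- (A3): `C_{xy} ≤ φ(|x - y|)` for a decreasing `φ ≥ 0` with `∑ i^{d+1} φ(i) < ∞` and
`φ(2i) ≤ c φ(i)`. As `φ` lives on `ℕ`, it is evaluated at the integer part of `|x - y|`. -/
def A3 : Prop :=
  ∃ φ : ℕ → ℝ, (∀ i, 0 ≤ φ i) ∧ Antitone φ ∧
    Summable (fun i : ℕ => (i : ℝ) ^ (d + 1) * φ i) ∧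
    (∃ c : ℝ, 0 < c ∧ ∀ i, φ (2 * i) ≤ c * φ i) ∧
    ∀ x y, C x y ≤ φ ⌊ZLat.eDist x y⌋₊

/-- (A4): `C_{xy} ≤ c C_{xy'}` whenever `|y - y'| ≤ |x - y| / 3`. -/
def A4 : Prop :=
  ∃ c : ℝ, 0 < c ∧ ∀ x y y' : ZLat d,
    ZLat.eDist y y' ≤ ZLat.eDist x y / 3 → C x y ≤ c * C x y'

/-- The one-step transition probability `P^x(X_1 = y) = C_{xy} / ν_x`. -/
noncomputable def stepProb (x y : ZLat d) : ℝ := C x y / nu C x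

/-- `h` is harmonic on `A` for the chain `X`: `∑_z h(z) P^x(X_1 = z) = h(x)` for `x ∈ A`,
the series being convergent. -/
def HarmonicOn (h : ZLat d → ℝ) (A : Set (ZLat d)) : Prop :=
  ∀ x ∈ A, HasSum (fun z => h z * stepProb C x z) (h x)

end IsConductance

/-!
The proof is analytic: it follows De Giorgi's method for the symmetric form
`∑ C_{xy} (f(x) - f(y))²` and uses no heat kernel. The summability in (A3) says that the second
moments `∑_y C_{xy} |x - y|²` are bounded, so that a cutoff function with slope `1 / r` has energy
density of order `r⁻²` in spite of the unbounded jumps. The paths of (A2) dominate the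
nearest-neighbour form, which gives Faber–Krahn and Poincaré inequalities
(`IsDiffusive.exists_faberKrahn`, `IsDiffusive.exists_poincare`). All estimates are made on finite
sets `W`; jumps out of `W` enter as error terms.

The core is the growth lemma `IsDiffusive.exists_growth`: a nonnegative function that is
superharmonic up to a small error and at least `1` on a third of a cube is bounded below on
the doubled cube. Testing the equation with `ψ² / (u + a)` and applying the Poincaré inequality to
`log (u + a)` shows that `u` is small on a small proportion of points only, and the De Giorgi
iteration (`IsDiffusive.exists_deGiorgi`) turns this into a pointwise bound. It holds at all radii,
down to a single lattice point. Iterated doubling gives expansion of positivity with a power law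
of exponent `γ` (`IsConductance.exists_expansion`).

For the Harnack inequality on a cube of radius `r` around `x₀`, let `x₁` maximize
`h(x) (2r - |x - x₀|)^γ`. Near `x₁` the function `h` hardly exceeds `h(x₁)`, and then
`IsConductance.exists_card_le_of_le` shows that `h` is comparable to `h(x₁)` on a third of a cube
whose radius is comparable to `2r - |x₁ - x₀|`. There the growth lemma is applied to
`(1 + ρ) h(x₁) - h`; the part of `h` that long jumps see is controlled by (A4), which
makes it comparable at different points, together with `IsConductance.exists_farSum_le`, which
bounds it where `h` is small. Expansion of positivity from that cube yields exactly the lower bound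
that matches the maximality of `x₁`. Euclidean balls are reached by chaining along lattice paths.
-/

/-! ### Cubes, distances and lattice paths -/

namespace ZLat

variable {d : ℕ}

/-- The open cube of radius `r` around `x`: the points at sup distance less than `r` (for `r ≥ 1`).
The cube of radius `1` is the single point `x`. -/
noncomputable def box (x : ZLat d) (r : ℕ) : Finset (ZLat d) :=
  Fintype.piFinset fun i => Finset.Ioo (x i - r) (x i + r)

theorem mem_box {x y : ZLat d} {r : ℕ} (hr : 0 < r) : y ∈ box x r ↔ dist y x < r := by
  rw [dist_pi_lt_iff (by exact_mod_cast hr)]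
  simp only [box, Fintype.mem_piFinset, Finset.mem_Ioo, Int.dist_eq, abs_lt]
  refine forall_congr' fun i => ?_
  constructor
  · rintro ⟨h1, h2⟩
    have h1' : (x i : ℝ) - r < y i := by exact_mod_cast h1
    have h2' : (y i : ℝ) < x i + r := by exact_mod_cast h2
    constructor <;> linarith
  · rintro ⟨h1, h2⟩
    constructor
    · have : (x i : ℝ) - r < y i := by linarith
      exact_mod_cast this
    · have : (y i : ℝ) < x i + r := by linarith
      exact_mod_cast this

theorem dist_le_of_lt_add_one {x y : ZLat d} {r : ℕ} (h : dist x y < r + 1) : dist x y ≤ r := by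
  rw [dist_pi_le_iff (by positivity)]
  intro i
  have h' := (dist_le_pi_dist x y i).trans_lt h
  rw [Int.dist_eq] at h' ⊢
  have h2 : |x i - y i| < (r : ℤ) + 1 := by exact_mod_cast h'
  have h3 : |x i - y i| ≤ (r : ℤ) := by omega
  exact_mod_cast h3

theorem card_box (x : ZLat d) {r : ℕ} (hr : 0 < r) : (box x r).card = (2 * r - 1) ^ d := by
  have h : ∀ i, ((x i + (r : ℤ)) - (x i - r) - 1).toNat = 2 * r - 1 := fun i => by omega
  simp only [box, Fintype.card_piFinset, Int.card_Ioo, h, Finset.prod_const, Finset.card_univ,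
    Fintype.card_fin]

theorem pow_le_card_box (x : ZLat d) {r : ℕ} (hr : 0 < r) : (r : ℝ) ^ d ≤ (box x r).card := by
  rw [card_box x hr]
  have : r ^ d ≤ (2 * r - 1) ^ d := Nat.pow_le_pow_left (by omega) d
  exact_mod_cast this

theorem card_box_le (x : ZLat d) {r : ℕ} (hr : 0 < r) : ((box x r).card : ℝ) ≤ (2 * r) ^ d := by
  rw [card_box x hr]
  have : (2 * r - 1) ^ d ≤ (2 * r) ^ d := Nat.pow_le_pow_left (by omega) d
  exact_mod_cast this

theorem self_mem_box (x : ZLat d) {r : ℕ} (hr : 0 < r) : x ∈ box x r := by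
  rw [mem_box hr, dist_self]; exact_mod_cast hr

theorem box_subset_box {x y : ZLat d} {r s : ℕ} (hr : 0 < r) (h : dist x y + r ≤ s) :
    box x r ⊆ box y s := by
  intro z hz
  have hs : 0 < s := by
    have : (0 : ℝ) < s := by
      have : (0 : ℝ) < r := by exact_mod_cast hr
      linarith [dist_nonneg (x := x) (y := y)]
    exact_mod_cast this
  rw [mem_box hr] at hz
  rw [mem_box hs]
  linarith [dist_triangle z x y]

theorem eDist_comm (x y : ZLat d) : eDist x y = eDist y x := by
  unfold eDist
  rw [← norm_neg]
  congr 1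
  ext i
  simp

theorem eDist_triangle (x y z : ZLat d) : eDist x z ≤ eDist x y + eDist y z := by
  unfold eDist
  refine le_trans (le_of_eq ?_) (norm_add_le _ _)
  congr 1
  ext i
  simp

theorem eDist_add_left (z x y : ZLat d) : eDist (z + x) (z + y) = eDist x y := by
  simp [eDist]

theorem dist_le_eDist (x y : ZLat d) : dist x y ≤ eDist x y := by
  refine (dist_pi_le_iff (norm_nonneg _)).2 ?_
  intro i
  have := PiLp.norm_apply_le
    (WithLp.toLp 2 (fun i => ((x i - y i : ℤ) : ℝ)) : EuclideanSpace ℝ (Fin d)) i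
  rw [Int.dist_eq]
  simpa [eDist] using this

theorem eDist_le_of_forall_abs_le {x y x' y' : ZLat d} (h : ∀ i, |x i - y i| ≤ |x' i - y' i|) :
    eDist x y ≤ eDist x' y' := by
  unfold eDist
  rw [EuclideanSpace.norm_eq, EuclideanSpace.norm_eq]
  refine Real.sqrt_le_sqrt (Finset.sum_le_sum fun i _ => ?_)
  have h' : (((|x i - y i| : ℤ) : ℝ)) ≤ ((|x' i - y' i| : ℤ) : ℝ) := by exact_mod_cast h i
  simp only [Int.cast_abs] at h'
  simp only [Real.norm_eq_abs]
  exact pow_le_pow_left₀ (abs_nonneg _) h' 2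

theorem eDist_le_mul_dist (x y : ZLat d) : eDist x y ≤ d * dist x y := by
  unfold eDist
  rw [EuclideanSpace.norm_eq]
  refine Real.sqrt_le_iff.2 ⟨by positivity, ?_⟩
  calc ∑ i, ‖(WithLp.toLp 2 (fun i => ((x i - y i : ℤ) : ℝ)) : EuclideanSpace ℝ (Fin d)) i‖ ^ 2
      ≤ ∑ _i : Fin d, dist x y ^ 2 := by
        refine Finset.sum_le_sum fun i _ => pow_le_pow_left₀ (norm_nonneg _) ?_ 2
        have := dist_le_pi_dist x y i
        rw [Int.dist_eq] at this
        simpa using this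
    _ = d * dist x y ^ 2 := by simp
    _ ≤ (d : ℝ) ^ 2 * dist x y ^ 2 := by
        gcongr
        have : d ≤ d ^ 2 := Nat.le_self_pow (by norm_num) d
        exact_mod_cast this
    _ = (d * dist x y) ^ 2 := by ring

/-- The number of unit steps of a shortest lattice path from `0` to `z`. -/
def length (z : ZLat d) : ℕ := ∑ i, (z i).natAbs

theorem length_le (z : ZLat d) : (length z : ℝ) ≤ d * dist z 0 := by
  unfold length
  push_cast
  calc ∑ i, ((z i).natAbs : ℝ) ≤ ∑ _i : Fin d, dist z 0 := by
        refine Finset.sum_le_sum fun i _ => ?_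
        have := dist_le_pi_dist z 0 i
        rw [Int.dist_eq] at this
        simpa [Nat.cast_natAbs] using this
    _ = d * dist z 0 := by simp

theorem eDist_update (z : ZLat d) (i : Fin d) (a : ℤ) (ha : |a - z i| = 1) :
    eDist (Function.update z i a) z = 1 := by
  unfold eDist
  rw [EuclideanSpace.norm_eq, Finset.sum_eq_single i]
  · have : ((|a - z i| : ℤ) : ℝ) = 1 := by exact_mod_cast ha
    simp only [Int.cast_abs] at this
    simp only [Function.update_self, Real.norm_eq_abs, this]
    simp
  · intro j _ hj
    simp [hj]
  · simp

/-- A lattice path of unit steps from `0` to `z` of minimal length, every coordinate of which moves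
monotonically; so all its points lie in the coordinate box spanned by `0` and `z`. -/
theorem exists_monotone_path (z : ZLat d) : ∃ p : ℕ → ZLat d, p 0 = 0 ∧ p (length z) = z ∧
    (∀ k < length z, eDist (p k) (p (k + 1)) = 1) ∧ ∀ k i, |p k i| ≤ |z i| := by
  induction hn : length z generalizing z with
  | zero =>
    have hz : z = 0 := by
      ext i
      have := (Finset.sum_eq_zero_iff.1 hn) i (Finset.mem_univ i)
      simpa using this
    refine ⟨fun _ => 0, rfl, hz.symm, by simp, by simp⟩
  | succ n ih =>
    obtain ⟨i, hi⟩ : ∃ i, z i ≠ 0 := by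
      by_contra! h
      simp [length, h] at hn
    obtain ⟨a, ha1, ha2, ha3⟩ : ∃ a : ℤ, |a - z i| = 1 ∧ a.natAbs + 1 = (z i).natAbs ∧
        |a| ≤ |z i| := by
      rcases lt_or_gt_of_ne hi with h | h
      · exact ⟨z i + 1, by simp, by omega, by rw [abs_of_nonpos, abs_of_neg h] <;> omega⟩
      · exact ⟨z i - 1, by simp, by omega, by rw [abs_of_nonneg, abs_of_pos h] <;> omega⟩
    have hlen : length (Function.update z i a) = n := by
      unfold length at hn ⊢
      rw [← Finset.add_sum_erase _ _ (Finset.mem_univ i)] at hn ⊢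
      have : ∑ j ∈ Finset.univ.erase i, (Function.update z i a j).natAbs =
          ∑ j ∈ Finset.univ.erase i, (z j).natAbs :=
        Finset.sum_congr rfl fun j hj => by simp [Finset.ne_of_mem_erase hj]
      rw [this, Function.update_self]
      omega
    obtain ⟨p, hp0, hpn, hp1, hp2⟩ := ih _ hlen
    refine ⟨fun k => if k ≤ n then p k else z, by simpa using hp0, by simp, ?_, ?_⟩
    · intro k hk
      rcases Nat.lt_succ_iff_lt_or_eq.1 hk with h | h
      · simp only [h.le, if_true, Nat.succ_le_of_lt h]
        exact hp1 k h
      · subst h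
        simp only [le_refl, if_true, Nat.not_succ_le_self, if_false, hpn]
        exact eDist_update z i a ha1
    · intro k j
      by_cases hk : k ≤ n
      · simp only [hk, if_true]
        refine (hp2 k j).trans ?_
        by_cases hj : j = i
        · subst hj; simpa using ha3
        · simp [hj]
      · simp [hk]

theorem dist_le_of_forall_abs_le {p z : ZLat d} (h : ∀ i, |p i| ≤ |z i|) :
    dist p 0 ≤ dist z 0 := by
  rw [dist_pi_le_iff dist_nonneg]
  intro i
  refine le_trans ?_ (dist_le_pi_dist z 0 i)
  rw [Int.dist_eq, Int.dist_eq]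
  have h' : (((|p i| : ℤ) : ℝ)) ≤ ((|z i| : ℤ) : ℝ) := by exact_mod_cast h i
  simpa using h'

end ZLat

/-! ### Second moments and short paths -/

theorem pow_sub_pow_le_mul {a b : ℝ} (hb : 0 ≤ b) (hab : b ≤ a) (n : ℕ) :
    a ^ (n + 1) - b ^ (n + 1) ≤ (n + 1) * (a - b) * a ^ n := by
  induction n with
  | zero => simp
  | succ n ih =>
    have h1 : a ^ (n + 2) - b ^ (n + 2) = a * (a ^ (n + 1) - b ^ (n + 1)) + b ^ (n + 1) * (a - b) := by
      ring
    have h2 : b ^ (n + 1) ≤ a ^ (n + 1) := pow_le_pow_left₀ hb hab _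
    have h3 := mul_le_mul_of_nonneg_left ih (hb.trans hab)
    have h4 := mul_le_mul_of_nonneg_right h2 (sub_nonneg.2 hab)
    rw [h1]
    push_cast
    calc _ ≤ a * ((n + 1) * (a - b) * a ^ n) + a ^ (n + 1) * (a - b) := add_le_add h3 h4
      _ = _ := by ring

/-- The quantitative content of (A2) and (A3) that the energy estimates use: symmetric conductances
with second moments (in the sup distance) at most `K`, such that lattice neighbours are joined
within Euclidean distance `M` by a path of at most `N` steps of conductance at least `δ`. -/
structure IsDiffusive {d : ℕ} (C : ZLat d → ZLat d → ℝ) (K δ M : ℝ) (N : ℕ) : Prop where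
  nonneg : ∀ x y, 0 ≤ C x y
  symm : ∀ x y, C x y = C y x
  moment_nonneg : 0 ≤ K
  moment : ∀ (x : ZLat d) (W : Finset (ZLat d)), ∑ y ∈ W, C x y * dist x y ^ 2 ≤ K
  delta_pos : 0 < δ
  one_le : 1 ≤ M
  path : ∀ x y : ZLat d, ZLat.eDist x y = 1 → ∃ n ≤ N, ∃ p : ℕ → ZLat d, p 0 = x ∧ p n = y ∧
    (∀ i ≤ n, ZLat.eDist x (p i) < M) ∧ ∀ i < n, δ ≤ C (p i) (p (i + 1))

namespace IsConductance

variable {d : ℕ} {C : ZLat d → ZLat d → ℝ}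

open ZLat

/-- A radial sum over a cube, taken over the spheres of the sup distance: the sphere of radius `n`
has `(2n+1)^d - (2n-1)^d = O(n^{d-1})` points. -/
theorem sum_box_radial_le {e : ℕ} (g : ℕ → ℝ) (hg : ∀ n, 0 ≤ g n) (hg0 : g 0 = 0)
    (x : ZLat (e + 1)) (R : ℕ) :
    ∑ y ∈ box x (R + 1), g ⌊dist x y⌋₊ ≤
      ∑ n ∈ Finset.range (R + 1), 2 * (e + 1) * (2 * n + 1) ^ e * g n := by
  induction R with
  | zero =>
    rw [Finset.sum_eq_zero]
    · simp [hg0]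
    · intro y hy
      rw [mem_box (by norm_num), dist_comm] at hy
      have : ⌊dist x y⌋₊ = 0 := Nat.floor_eq_zero.2 (by simpa using hy)
      rw [this, hg0]
  | succ R ih =>
    have hsub : box x (R + 1) ⊆ box x (R + 1 + 1) :=
      box_subset_box (by omega) (by simp)
    rw [← Finset.sum_sdiff hsub, Finset.sum_range_succ, add_comm]
    refine add_le_add ih ?_
    have h1 : ∀ y ∈ box x (R + 1 + 1) \ box x (R + 1), g ⌊dist x y⌋₊ = g (R + 1) := by
      intro y hy
      rw [Finset.mem_sdiff, mem_box (by omega), mem_box (by omega), dist_comm, not_lt] at hy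
      congr 1
      rw [Nat.floor_eq_iff dist_nonneg]
      exact ⟨hy.2, by simpa using hy.1⟩
    rw [Finset.sum_congr rfl h1, Finset.sum_const, nsmul_eq_mul]
    refine mul_le_mul_of_nonneg_right ?_ (hg _)
    rw [Finset.cast_card_sdiff hsub, card_box x (by omega), card_box x (by omega)]
    have h2 : 2 * (R + 1 + 1) - 1 = 2 * R + 3 := by omega
    have h3 : 2 * (R + 1) - 1 = 2 * R + 1 := by omega
    rw [h2, h3]
    push_cast
    refine (pow_sub_pow_le_mul (by positivity) (by linarith) e).trans (le_of_eq ?_)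
    ring

theorem exists_moment_bound (hC : IsConductance C) (h3 : A3 C) (hd : 0 < d) :
    ∃ K : ℝ, 0 ≤ K ∧ ∀ (x : ZLat d) (W : Finset (ZLat d)), ∑ y ∈ W, C x y * dist x y ^ 2 ≤ K := by
  obtain ⟨φ, hφ0, hφ, hsum, -, hCφ⟩ := h3
  obtain ⟨e, rfl⟩ : ∃ e, d = e + 1 := ⟨d - 1, by omega⟩
  refine ⟨2 * (e + 1) * 3 ^ e * ∑' i : ℕ, (i : ℝ) ^ (e + 1 + 1) * φ i, ?_, fun x W => ?_⟩
  · have : 0 ≤ ∑' i : ℕ, (i : ℝ) ^ (e + 1 + 1) * φ i :=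
      tsum_nonneg fun i => mul_nonneg (by positivity) (hφ0 i)
    positivity
  obtain ⟨R, hR⟩ : ∃ R : ℕ, W ⊆ box x (R + 1) := by
    obtain ⟨R, hR⟩ := exists_nat_gt (∑ y ∈ W, dist y x)
    refine ⟨R, fun y hy => (mem_box (by omega)).2 ?_⟩
    have := Finset.single_le_sum (f := fun y => dist y x) (fun _ _ => dist_nonneg) hy
    push_cast
    linarith
  calc ∑ y ∈ W, C x y * dist x y ^ 2 ≤ ∑ y ∈ box x (R + 1), C x y * dist x y ^ 2 :=
        Finset.sum_le_sum_of_subset_of_nonneg hR fun y _ _ =>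
          mul_nonneg (hC.nonneg x y) (by positivity)
    _ ≤ ∑ y ∈ box x (R + 1), φ ⌊dist x y⌋₊ * (⌊dist x y⌋₊ : ℝ) ^ 2 := by
        refine Finset.sum_le_sum fun y _ => ?_
        have h1 : dist x y ≤ ⌊dist x y⌋₊ := dist_le_of_lt_add_one (Nat.lt_floor_add_one _)
        have h2 : C x y ≤ φ ⌊dist x y⌋₊ :=
          (hCφ x y).trans (hφ (Nat.floor_le_floor (dist_le_eDist x y)))
        exact mul_le_mul h2 (pow_le_pow_left₀ dist_nonneg h1 2) (by positivity) (hφ0 _)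
    _ ≤ ∑ n ∈ Finset.range (R + 1), 2 * (e + 1) * (2 * n + 1) ^ e * (φ n * (n : ℝ) ^ 2) :=
        sum_box_radial_le (fun n => φ n * (n : ℝ) ^ 2)
          (fun n => mul_nonneg (hφ0 n) (by positivity)) (by simp) x R
    _ ≤ ∑ n ∈ Finset.range (R + 1), 2 * (e + 1) * 3 ^ e * ((n : ℝ) ^ (e + 1 + 1) * φ n) := by
        refine Finset.sum_le_sum fun n _ => ?_
        rcases Nat.eq_zero_or_pos n with rfl | hn
        · simp
        have hn' : (1 : ℝ) ≤ n := by exact_mod_cast hn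
        have h1 : (2 * (n : ℝ) + 1) ^ e ≤ (3 * n) ^ e :=
          pow_le_pow_left₀ (by positivity) (by linarith) e
        have := hφ0 n
        calc 2 * ((e : ℝ) + 1) * (2 * n + 1) ^ e * (φ n * (n : ℝ) ^ 2)
            ≤ 2 * (e + 1) * (3 * n) ^ e * (φ n * (n : ℝ) ^ 2) := by gcongr
          _ = _ := by rw [mul_pow]; ring
    _ ≤ _ := by
        rw [← Finset.mul_sum]
        refine mul_le_mul_of_nonneg_left ?_ (by positivity)
        exact hsum.sum_le_tsum _ fun i _ => mul_nonneg (by positivity) (hφ0 i)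

/-- In (A2) the number of steps may be bounded uniformly, as a path may be taken
without repetitions inside a finite ball. -/
theorem exists_short_path {M : ℝ} (hC : IsConductance C) (h2 : A2 C M) :
    1 ≤ M ∧ ∃ (δ : ℝ) (N : ℕ), 0 < δ ∧ ∀ x y : ZLat d, eDist x y = 1 → ∃ n ≤ N,
      ∃ p : ℕ → ZLat d, p 0 = x ∧ p n = y ∧ (∀ i ≤ n, eDist x (p i) < M) ∧
        ∀ i < n, δ ≤ C (p i) (p (i + 1)) := by
  classical
  obtain ⟨hM, δ, hδ, h⟩ := h2
  have hm : 0 < ⌈M⌉₊ := Nat.ceil_pos.2 (by linarith)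
  refine ⟨hM, δ, (2 * ⌈M⌉₊ - 1) ^ d, hδ, fun x y hxy => ?_⟩
  obtain ⟨n, p, hn, hp1, hpn, hp, hpC⟩ := h x y hxy
  let B : Finset (ZLat d) := (box x ⌈M⌉₊).filter fun z => eDist x z < M
  have hB : ∀ i, 1 ≤ i → i ≤ n → p i ∈ B := fun i hi hi' => by
    have h1 : eDist x (p i) < M := hp i hi hi'
    refine Finset.mem_filter.2 ⟨(mem_box hm).2 ?_, h1⟩
    rw [dist_comm]
    exact (dist_le_eDist x (p i)).trans_lt (h1.trans_le (Nat.le_ceil M))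
  let G : SimpleGraph B :=
    { Adj := fun a b => a ≠ b ∧ δ ≤ C a b
      symm := ⟨fun a b hab => ⟨hab.1.symm, by rw [hC.symm]; exact hab.2⟩⟩
      loopless := ⟨fun a ha => ha.1 rfl⟩ }
  have hreach : ∀ i (hi : 1 ≤ i) (hi' : i ≤ n),
      G.Reachable ⟨p 1, hB 1 le_rfl (by omega)⟩ ⟨p i, hB i hi hi'⟩ := by
    intro i hi
    induction i, hi using Nat.le_induction with
    | base => intro _; exact SimpleGraph.Reachable.refl _
    | succ i hi ih =>
      intro hi'
      refine (ih (by omega)).trans ?_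
      by_cases heq : p i = p (i + 1)
      · have : (⟨p i, hB i hi (by omega)⟩ : B) = ⟨p (i + 1), hB (i + 1) (by omega) hi'⟩ :=
          Subtype.ext heq
        rw [this]
      · exact SimpleGraph.Adj.reachable
          ⟨fun hh => heq (congrArg Subtype.val hh), hpC i hi (by omega)⟩
  obtain ⟨w, hw⟩ := (hreach n (by omega) le_rfl).exists_isPath
  refine ⟨w.length, ?_, fun i => w.getVert i, ?_, ?_, ?_, ?_⟩
  · refine (hw.length_lt.le).trans ?_
    rw [Fintype.card_coe, ← card_box x hm]
    exact Finset.card_filter_le _ _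
  · simpa using hp1
  · simpa using hpn
  · intro i _
    exact (Finset.mem_filter.1 (w.getVert i).2).2
  · intro i hi
    exact (w.adj_getVert_succ hi).2

theorem exists_isDiffusive {M : ℝ} (hC : IsConductance C) (h2 : A2 C M) (h3 : A3 C) (hd : 0 < d) :
    ∃ (K δ : ℝ) (N : ℕ), IsDiffusive C K δ M N := by
  obtain ⟨K, hK0, hK⟩ := exists_moment_bound hC h3 hd
  obtain ⟨hM, δ, N, hδ, hp⟩ := exists_short_path hC h2
  exact ⟨K, δ, N, hC.nonneg, hC.symm, hK0, hK, hδ, hM, hp⟩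

end IsConductance

/-! ### Faber–Krahn and Poincaré inequalities -/

namespace IsDiffusive

variable {d : ℕ} {C : ZLat d → ZLat d → ℝ} {K δ M : ℝ} {N : ℕ}

open ZLat

/-- The Dirichlet form of the chain restricted to the finite set `W`, summed over ordered pairs. -/
def energy (C : ZLat d → ZLat d → ℝ) (W : Finset (ZLat d)) (f : ZLat d → ℝ) : ℝ :=
  ∑ x ∈ W, ∑ y ∈ W, C x y * (f x - f y) ^ 2

theorem ceil_pos (hD : IsDiffusive C K δ M N) : 0 < ⌈M⌉₊ :=
  Nat.ceil_pos.2 (by linarith [hD.one_le])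

theorem energy_nonneg (hD : IsDiffusive C K δ M N) (W : Finset (ZLat d)) (f : ZLat d → ℝ) :
    0 ≤ energy C W f :=
  Finset.sum_nonneg fun x _ => Finset.sum_nonneg fun y _ =>
    mul_nonneg (hD.nonneg x y) (sq_nonneg _)

theorem sq_sub_le_sum_box (hD : IsDiffusive C K δ M N) (f : ZLat d → ℝ) {a b : ZLat d}
    (hab : eDist a b = 1) :
    (f a - f b) ^ 2 ≤ N ^ 2 / δ * ∑ u ∈ box a ⌈M⌉₊, ∑ v ∈ box a ⌈M⌉₊, C u v * (f u - f v) ^ 2 := by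
  obtain ⟨n, hn, p, hp0, hpn, hp, hpC⟩ := hD.path a b hab
  have hδ := hD.delta_pos
  set S := ∑ u ∈ box a ⌈M⌉₊, ∑ v ∈ box a ⌈M⌉₊, C u v * (f u - f v) ^ 2 with hS
  have hterm : ∀ u v, 0 ≤ C u v * (f u - f v) ^ 2 := fun u v =>
    mul_nonneg (hD.nonneg u v) (sq_nonneg _)
  have hS0 : 0 ≤ S := Finset.sum_nonneg fun u _ => Finset.sum_nonneg fun v _ => hterm u v
  have hmem : ∀ i ≤ n, p i ∈ box a ⌈M⌉₊ := fun i hi => by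
    rw [mem_box hD.ceil_pos, dist_comm]
    exact (dist_le_eDist _ _).trans_lt ((hp i hi).trans_le (Nat.le_ceil M))
  have h1 : ∀ i ∈ Finset.range n, (f (p (i + 1)) - f (p i)) ^ 2 ≤ S / δ := by
    intro i hi
    rw [Finset.mem_range] at hi
    rw [le_div_iff₀ hδ]
    calc (f (p (i + 1)) - f (p i)) ^ 2 * δ ≤ C (p i) (p (i + 1)) * (f (p i) - f (p (i + 1))) ^ 2 := by
          have := mul_le_mul_of_nonneg_right (hpC i hi) (sq_nonneg (f (p i) - f (p (i + 1))))
          linarith [this]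
      _ ≤ ∑ v ∈ box a ⌈M⌉₊, C (p i) v * (f (p i) - f v) ^ 2 :=
          Finset.single_le_sum (f := fun v => C (p i) v * (f (p i) - f v) ^ 2)
            (fun v _ => hterm _ v) (hmem (i + 1) hi)
      _ ≤ S := Finset.single_le_sum
            (f := fun u => ∑ v ∈ box a ⌈M⌉₊, C u v * (f u - f v) ^ 2)
            (fun u _ => Finset.sum_nonneg fun v _ => hterm _ v) (hmem i hi.le)
  have h2 : f b - f a = ∑ i ∈ Finset.range n, (f (p (i + 1)) - f (p i)) := by
    rw [Finset.sum_range_sub (fun i => f (p i)), hp0, hpn]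
  have hnN : (n : ℝ) ≤ N := by exact_mod_cast hn
  calc (f a - f b) ^ 2 = (∑ i ∈ Finset.range n, (f (p (i + 1)) - f (p i))) ^ 2 := by
        rw [← h2]; ring
    _ ≤ n * ∑ i ∈ Finset.range n, (f (p (i + 1)) - f (p i)) ^ 2 := by
        simpa using sq_sum_le_card_mul_sum_sq (s := Finset.range n)
          (f := fun i => f (p (i + 1)) - f (p i))
    _ ≤ n * ∑ _i ∈ Finset.range n, S / δ := by gcongr with i hi; exact h1 i hi
    _ = n * (n * (S / δ)) := by simp
    _ ≤ N * (N * (S / δ)) := by gcongr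
    _ = N ^ 2 / δ * S := by ring

/-- The nearest-neighbour Dirichlet form is dominated by that of the chain; this is where the
paths of (A2) enter. -/
theorem exists_sum_sq_step_le (hD : IsDiffusive C K δ M N) :
    ∃ A : ℝ, 0 ≤ A ∧ ∀ (W T : Finset (ZLat d)) (f : ZLat d → ℝ) (p q : ZLat d), eDist p q = 1 →
      (∀ x ∈ T, box (x + p) ⌈M⌉₊ ⊆ W) →
      ∑ x ∈ T, (f (x + p) - f (x + q)) ^ 2 ≤ A * energy C W f := by
  have hδ := hD.delta_pos
  refine ⟨N ^ 2 / δ * (2 * ⌈M⌉₊) ^ d, by positivity, fun W T f p q hpq hW => ?_⟩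
  have hterm : ∀ u v, 0 ≤ C u v * (f u - f v) ^ 2 := fun u v =>
    mul_nonneg (hD.nonneg u v) (sq_nonneg _)
  set G : ZLat d → ℝ := fun u => ∑ v ∈ W, C u v * (f u - f v) ^ 2 with hG
  have hG0 : ∀ u, 0 ≤ G u := fun u => Finset.sum_nonneg fun v _ => hterm u v
  calc ∑ x ∈ T, (f (x + p) - f (x + q)) ^ 2
      ≤ ∑ x ∈ T, N ^ 2 / δ * ∑ u ∈ box (x + p) ⌈M⌉₊, G u := by
        refine Finset.sum_le_sum fun x hx => ?_
        refine (hD.sq_sub_le_sum_box f (by rwa [eDist_add_left])).trans ?_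
        refine mul_le_mul_of_nonneg_left ?_ (by positivity)
        exact Finset.sum_le_sum fun u _ =>
          Finset.sum_le_sum_of_subset_of_nonneg (hW x hx) fun v _ _ => hterm u v
    _ = N ^ 2 / δ * ∑ x ∈ T, ∑ u ∈ box (x + p) ⌈M⌉₊, G u := by rw [Finset.mul_sum]
    _ = N ^ 2 / δ * ∑ u ∈ W, ∑ x ∈ T with u ∈ box (x + p) ⌈M⌉₊, G u := by
        congr 1
        refine Finset.sum_comm' fun x u => ?_
        simp only [Finset.mem_filter]
        constructor
        · rintro ⟨hx, hu⟩; exact ⟨⟨hx, hu⟩, hW x hx hu⟩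
        · rintro ⟨⟨hx, hu⟩, -⟩; exact ⟨hx, hu⟩
    _ ≤ N ^ 2 / δ * ∑ u ∈ W, (2 * ⌈M⌉₊) ^ d * G u := by
        refine mul_le_mul_of_nonneg_left (Finset.sum_le_sum fun u _ => ?_) (by positivity)
        rw [Finset.sum_const, nsmul_eq_mul]
        refine mul_le_mul_of_nonneg_right ?_ (hG0 u)
        refine le_trans ?_ (card_box_le (u - p) hD.ceil_pos)
        refine Nat.cast_le.2 (Finset.card_le_card fun x hx => ?_)
        have hx2 := (Finset.mem_filter.1 hx).2
        rw [mem_box hD.ceil_pos] at hx2 ⊢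
        rw [dist_comm, dist_eq_norm] at hx2
        rw [dist_eq_norm]
        convert hx2 using 2
        abel
    _ = N ^ 2 / δ * (2 * ⌈M⌉₊) ^ d * energy C W f := by
        rw [← Finset.mul_sum, energy]; ring

/-- Differences along a translation `z` are controlled by unit differences, by telescoping along a
lattice path from `0` to `z`. -/
theorem sum_sq_translate_le (f : ZLat d → ℝ) (S : Finset (ZLat d)) (z : ZLat d) {G : ℝ}
    (hG0 : 0 ≤ G)
    (hG : ∀ p q, eDist p q = 1 → dist p 0 ≤ dist z 0 → dist q 0 ≤ dist z 0 →
      ∑ x ∈ S, (f (x + p) - f (x + q)) ^ 2 ≤ G) :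
    ∑ x ∈ S, (f (x + z) - f x) ^ 2 ≤ (d * dist z 0) ^ 2 * G := by
  obtain ⟨p, hp0, hpn, hp1, hp2⟩ := exists_monotone_path z
  set n := length z
  have hdist : ∀ k, dist (p k) 0 ≤ dist z 0 := fun k => dist_le_of_forall_abs_le (hp2 k)
  calc ∑ x ∈ S, (f (x + z) - f x) ^ 2
      ≤ ∑ x ∈ S, n * ∑ k ∈ Finset.range n, (f (x + p (k + 1)) - f (x + p k)) ^ 2 := by
        refine Finset.sum_le_sum fun x _ => ?_
        have h : f (x + z) - f x = ∑ k ∈ Finset.range n, (f (x + p (k + 1)) - f (x + p k)) := by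
          rw [Finset.sum_range_sub (fun k => f (x + p k)), hp0, hpn, add_zero]
        rw [h]
        simpa using sq_sum_le_card_mul_sum_sq (s := Finset.range n)
          (f := fun k => f (x + p (k + 1)) - f (x + p k))
    _ = n * ∑ k ∈ Finset.range n, ∑ x ∈ S, (f (x + p k) - f (x + p (k + 1))) ^ 2 := by
        rw [← Finset.mul_sum, Finset.sum_comm]
        congr 1
        exact Finset.sum_congr rfl fun k _ => Finset.sum_congr rfl fun x _ => by ring
    _ ≤ n * ∑ k ∈ Finset.range n, G := by
        gcongr with k hk
        exact hG _ _ (hp1 k (Finset.mem_range.1 hk)) (hdist _) (hdist _)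
    _ = (n : ℝ) ^ 2 * G := by simp; ring
    _ ≤ (d * dist z 0) ^ 2 * G := by
        gcongr
        exact length_le z

/-- **Faber–Krahn inequality.** A function supported on a set of at most `ℓ ^ d / 2` points
has spectral gap at least of order `ℓ⁻²`: most translates by vectors of size `ℓ` move any given
point out of the support. -/
theorem exists_faberKrahn (hD : IsDiffusive C K δ M N) :
    ∃ A : ℝ, 0 ≤ A ∧ ∀ (W S : Finset (ZLat d)) (f : ZLat d → ℝ) (ℓ : ℕ), 0 < ℓ →
      (∀ x ∉ S, f x = 0) → (∀ y ∈ S, box y (⌈M⌉₊ + 1) ⊆ W) → 2 * S.card ≤ ℓ ^ d →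
      ∑ x ∈ S, f x ^ 2 ≤ A * ℓ ^ 2 * energy C W f := by
  classical
  obtain ⟨A, hA0, hA⟩ := hD.exists_sum_sq_step_le
  refine ⟨2 * d ^ 2 * A, by positivity, fun W S f ℓ hℓ hf hW hcard => ?_⟩
  have hE := hD.energy_nonneg W f
  have hG : ∀ p q, eDist p q = 1 → ∑ x ∈ S, (f (x + p) - f (x + q)) ^ 2 ≤ A * energy C W f := by
    intro p q hpq
    have h1 : ∑ x ∈ S with x + p ∈ S ∨ x + q ∈ S, (f (x + p) - f (x + q)) ^ 2 =
        ∑ x ∈ S, (f (x + p) - f (x + q)) ^ 2 := by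
      refine Finset.sum_filter_of_ne fun x _ hne => ?_
      by_contra! hcon
      exact hne (by rw [hf _ hcon.1, hf _ hcon.2]; ring)
    rw [← h1]
    refine hA W _ f p q hpq fun x hx => ?_
    rcases (Finset.mem_filter.1 hx).2 with h | h
    · refine (box_subset_box hD.ceil_pos ?_).trans (hW _ h)
      simp
    · refine (box_subset_box hD.ceil_pos ?_).trans (hW _ h)
      have : dist (x + p) (x + q) ≤ 1 :=
        (dist_le_eDist _ _).trans_eq (by rw [eDist_add_left, hpq])
      push_cast
      linarith
  let Z : Finset (ZLat d) := Fintype.piFinset fun _ => Finset.Ico (0 : ℤ) ℓ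
  have hZcard : Z.card = ℓ ^ d := by simp [Z]
  have hZ : ∀ z ∈ Z, dist z 0 ≤ ℓ := by
    intro z hz
    rw [dist_pi_le_iff (by positivity)]
    intro i
    have hzi := Finset.mem_Ico.1 (Fintype.mem_piFinset.1 hz i)
    rw [Int.dist_eq]
    have h1 : |z i| ≤ (ℓ : ℤ) := by rw [abs_of_nonneg hzi.1]; exact hzi.2.le
    simpa using (by exact_mod_cast h1 : (|z i| : ℝ) ≤ ℓ)
  have hup : ∑ z ∈ Z, ∑ x ∈ S, (f (x + z) - f x) ^ 2 ≤
      ℓ ^ d * ((d * ℓ) ^ 2 * (A * energy C W f)) := by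
    calc ∑ z ∈ Z, ∑ x ∈ S, (f (x + z) - f x) ^ 2
        ≤ ∑ z ∈ Z, (d * ℓ : ℝ) ^ 2 * (A * energy C W f) := by
          refine Finset.sum_le_sum fun z hz => ?_
          refine (sum_sq_translate_le f S z (by positivity) fun p q hpq _ _ => hG p q hpq).trans ?_
          have := hZ z hz
          gcongr
      _ = _ := by rw [Finset.sum_const, hZcard, nsmul_eq_mul]; push_cast; ring
  have hlow : ∑ x ∈ S, (ℓ : ℝ) ^ d / 2 * f x ^ 2 ≤ ∑ z ∈ Z, ∑ x ∈ S, (f (x + z) - f x) ^ 2 := by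
    rw [Finset.sum_comm]
    refine Finset.sum_le_sum fun x _ => ?_
    have h1 : ((Z.filter fun z => x + z ∈ S).card : ℝ) ≤ S.card := by
      refine Nat.cast_le.2 (Finset.card_le_card_of_injOn (fun z => x + z) ?_ ?_)
      · intro z hz
        simpa using (Finset.mem_filter.1 (Finset.mem_coe.1 hz)).2
      · intro a _ b _ hab
        simpa using hab
    have h2 : ((Z.filter fun z => x + z ∈ S).card : ℝ) + (Z.filter fun z => x + z ∉ S).card =
        ℓ ^ d := by
      have := Finset.card_filter_add_card_filter_not (s := Z) (fun z => x + z ∈ S)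
      rw [hZcard] at this
      exact_mod_cast this
    have h3 : (2 : ℝ) * S.card ≤ ℓ ^ d := by exact_mod_cast hcard
    calc (ℓ : ℝ) ^ d / 2 * f x ^ 2 ≤ (Z.filter fun z => x + z ∉ S).card * f x ^ 2 := by
          refine mul_le_mul_of_nonneg_right ?_ (sq_nonneg _)
          linarith
      _ = ∑ z ∈ Z with x + z ∉ S, (f (x + z) - f x) ^ 2 := by
          rw [← nsmul_eq_mul, ← Finset.sum_const]
          refine Finset.sum_congr rfl fun z hz => ?_
          rw [hf _ (Finset.mem_filter.1 hz).2]
          ring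
      _ ≤ _ := Finset.sum_le_sum_of_subset_of_nonneg (Finset.filter_subset _ _)
          fun _ _ _ => sq_nonneg _
  rw [← Finset.mul_sum] at hlow
  have hpos : (0 : ℝ) < ℓ ^ d := by positivity
  have h := hlow.trans hup
  have h' : (ℓ : ℝ) ^ d * ∑ x ∈ S, f x ^ 2 ≤
      ℓ ^ d * (2 * d ^ 2 * A * ℓ ^ 2 * energy C W f) := by
    linarith [h]
  exact le_of_mul_le_mul_left h' hpos

/-- **Poincaré inequality** for functions vanishing on a fixed proportion of a cube. -/
theorem exists_poincare (hD : IsDiffusive C K δ M N) :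
    ∃ A : ℝ, 0 ≤ A ∧ ∀ (x₀ : ZLat d) (r : ℕ), 0 < r → ∀ (W Z : Finset (ZLat d)) (v : ZLat d → ℝ),
      box x₀ ((9 + ⌈M⌉₊) * r) ⊆ W → Z ⊆ box x₀ r → (box x₀ r).card ≤ 3 * Z.card →
      (∀ z ∈ Z, v z = 0) → ∑ x ∈ box x₀ (4 * r), v x ^ 2 ≤ A * r ^ 2 * energy C W v := by
  classical
  obtain ⟨A, hA0, hA⟩ := hD.exists_sum_sq_step_le
  refine ⟨3 * 10 ^ d * (5 * d) ^ 2 * A, by positivity, fun x₀ r hr W Z v hW hZ hcard hv => ?_⟩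
  have hE := hD.energy_nonneg W v
  have hr1 : (1 : ℝ) ≤ r := by exact_mod_cast hr
  have hM0 := hD.ceil_pos
  have hup : ∑ z ∈ box (0 : ZLat d) (5 * r), ∑ x ∈ box x₀ (4 * r), (v (x + z) - v x) ^ 2 ≤
      (10 * r) ^ d * ((d * (5 * r)) ^ 2 * (A * energy C W v)) := by
    calc ∑ z ∈ box (0 : ZLat d) (5 * r), ∑ x ∈ box x₀ (4 * r), (v (x + z) - v x) ^ 2
        ≤ ∑ z ∈ box (0 : ZLat d) (5 * r), (d * (5 * r) : ℝ) ^ 2 * (A * energy C W v) := by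
          refine Finset.sum_le_sum fun z hz => ?_
          rw [mem_box (by omega)] at hz
          push_cast at hz
          refine (sum_sq_translate_le v _ z (by positivity) fun p q hpq hp _ =>
            hA W _ v p q hpq fun x hx => ?_).trans ?_
          · refine (box_subset_box hM0 ?_).trans hW
            rw [mem_box (by omega)] at hx
            push_cast at hx ⊢
            have h1 : dist (x + p) x₀ ≤ dist x x₀ + dist p 0 := by
              have : dist (x + p) x = dist p 0 := by simp [dist_eq_norm]
              linarith [dist_triangle (x + p) x x₀]
            have h2 : (⌈M⌉₊ : ℝ) ≤ ⌈M⌉₊ * r := by nlinarith [Nat.cast_nonneg (α := ℝ) ⌈M⌉₊]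
            linarith
          · gcongr
      _ ≤ _ := by
          rw [Finset.sum_const, nsmul_eq_mul]
          refine mul_le_mul_of_nonneg_right ?_ (by positivity)
          refine (card_box_le _ (by omega)).trans (le_of_eq ?_)
          push_cast; ring
  have hlow : ∑ x ∈ box x₀ (4 * r), (Z.card : ℝ) * v x ^ 2 ≤
      ∑ z ∈ box (0 : ZLat d) (5 * r), ∑ x ∈ box x₀ (4 * r), (v (x + z) - v x) ^ 2 := by
    rw [Finset.sum_comm]
    refine Finset.sum_le_sum fun x hx => ?_
    rw [mem_box (by omega)] at hx
    push_cast at hx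
    calc (Z.card : ℝ) * v x ^ 2 = ∑ y ∈ Z, (v (x + (y - x)) - v x) ^ 2 := by
          rw [← nsmul_eq_mul, ← Finset.sum_const]
          refine Finset.sum_congr rfl fun y hy => ?_
          rw [add_sub_cancel, hv y hy]
          ring
      _ = ∑ z ∈ Z.image (fun y => y - x), (v (x + z) - v x) ^ 2 := by
          rw [Finset.sum_image]
          intro a _ b _ hab
          simpa using hab
      _ ≤ _ := by
          refine Finset.sum_le_sum_of_subset_of_nonneg ?_ fun _ _ _ => sq_nonneg _
          intro z hz
          obtain ⟨y, hy, rfl⟩ := Finset.mem_image.1 hz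
          have hy' := hZ hy
          rw [mem_box hr] at hy'
          rw [mem_box (by omega)]
          have : dist (y - x) 0 = dist y x := by simp [dist_eq_norm]
          push_cast
          linarith [dist_triangle_right y x x₀]
  rw [← Finset.mul_sum] at hlow
  have h1 : (r : ℝ) ^ d ≤ 3 * Z.card :=
    (pow_le_card_box x₀ hr).trans (by exact_mod_cast hcard)
  have hpos : (0 : ℝ) < r ^ d := by positivity
  have hs : 0 ≤ ∑ x ∈ box x₀ (4 * r), v x ^ 2 := Finset.sum_nonneg fun _ _ => sq_nonneg _
  have h := hlow.trans hup
  have h' : (r : ℝ) ^ d * ∑ x ∈ box x₀ (4 * r), v x ^ 2 ≤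
      r ^ d * (3 * 10 ^ d * (5 * d) ^ 2 * A * r ^ 2 * energy C W v) := by
    rw [mul_pow] at h
    calc _ ≤ 3 * (Z.card * ∑ x ∈ box x₀ (4 * r), v x ^ 2) := by nlinarith
      _ ≤ 3 * (10 ^ d * r ^ d * ((d * (5 * r)) ^ 2 * (A * energy C W v))) := by linarith
      _ = _ := by ring
  exact le_of_mul_le_mul_left h' hpos

end IsDiffusive

/-! ### Caccioppoli inequalities -/

theorem sq_log_sub_log_le {a b : ℝ} (ha : 0 < a) (hb : 0 < b) :
    (Real.log a - Real.log b) ^ 2 ≤ 4 * ((a - b) ^ 2 / (a * b)) := by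
  wlog hab : b ≤ a generalizing a b
  · have := this hb ha (le_of_not_ge hab)
    calc _ = (Real.log b - Real.log a) ^ 2 := by ring
      _ ≤ _ := this
      _ = _ := by rw [mul_comm b a]; ring
  obtain ⟨s, hs, hs1, rfl⟩ : ∃ s : ℝ, 0 < s ∧ 1 ≤ s ∧ a = s ^ 2 * b := by
    refine ⟨√(a / b), Real.sqrt_pos.2 (by positivity), ?_, ?_⟩
    · rw [Real.one_le_sqrt, one_le_div hb]; exact hab
    · rw [Real.sq_sqrt (by positivity)]; field_simp
  have h1 : Real.log (s ^ 2 * b) - Real.log b = 2 * Real.log s := by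
    rw [Real.log_mul (by positivity) hb.ne', Real.log_pow]; push_cast; ring
  have h2 : Real.log s ≤ s - 1 := Real.log_le_sub_one_of_pos hs
  have h3 : 0 ≤ Real.log s := Real.log_nonneg hs1
  have h4 : (s ^ 2 * b - b) ^ 2 / (s ^ 2 * b * b) = (s - 1) ^ 2 * ((s + 1) / s) ^ 2 := by
    field_simp; ring
  have h5 : 1 ≤ (s + 1) / s := by rw [one_le_div hs]; linarith
  rw [h1, h4]
  nlinarith [sq_nonneg (s - 1), mul_le_mul_of_nonneg_left (one_le_pow₀ h5 (n := 2)) (sq_nonneg (s - 1))]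

theorem sub_mul_div_sub_div_le {a b : ℝ} (ha : 0 < a) (hb : 0 < b) (p q : ℝ) :
    (a - b) * (p ^ 2 / a - q ^ 2 / b) ≤ (p - q) ^ 2 := by
  have h : (p - q) ^ 2 - (a - b) * (p ^ 2 / a - q ^ 2 / b) = (p * b - q * a) ^ 2 / (a * b) := by
    field_simp; ring
  have : 0 ≤ (p * b - q * a) ^ 2 / (a * b) := by positivity
  linarith

namespace IsDiffusive

variable {d : ℕ} {C : ZLat d → ZLat d → ℝ} {K δ M : ℝ} {N : ℕ}

open ZLat

/-- A Lipschitz cutoff function with slope `s` that vanishes at distance at least `ρ` from `x₀`. -/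
noncomputable def cutoff (x₀ : ZLat d) (ρ s : ℝ) (x : ZLat d) : ℝ :=
  max 0 (min 1 (s * (ρ - dist x x₀)))

theorem cutoff_nonneg (x₀ : ZLat d) (ρ s : ℝ) (x : ZLat d) : 0 ≤ cutoff x₀ ρ s x := le_max_left _ _

theorem cutoff_le_one (x₀ : ZLat d) (ρ s : ℝ) (x : ZLat d) : cutoff x₀ ρ s x ≤ 1 :=
  max_le zero_le_one (min_le_left _ _)

theorem cutoff_eq_zero {x₀ x : ZLat d} {ρ s : ℝ} (hs : 0 ≤ s) (h : ρ ≤ dist x x₀) :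
    cutoff x₀ ρ s x = 0 :=
  max_eq_left ((min_le_right _ _).trans (mul_nonpos_of_nonneg_of_nonpos hs (by linarith)))

theorem cutoff_eq_one {x₀ x : ZLat d} {ρ s : ℝ} (h : 1 ≤ s * (ρ - dist x x₀)) :
    cutoff x₀ ρ s x = 1 := by
  rw [cutoff, min_eq_left h, max_eq_right zero_le_one]

theorem abs_cutoff_sub_le (x₀ : ZLat d) {ρ s : ℝ} (hs : 0 ≤ s) (x y : ZLat d) :
    |cutoff x₀ ρ s x - cutoff x₀ ρ s y| ≤ s * dist x y := by
  unfold cutoff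
  refine (abs_max_sub_max_le_max _ _ _ _).trans ?_
  rw [sub_self, abs_zero]
  refine max_le (by positivity) ((abs_min_sub_min_le_max _ _ _ _).trans ?_)
  rw [sub_self, abs_zero]
  refine max_le (by positivity) ?_
  rw [← mul_sub, abs_mul, abs_of_nonneg hs]
  refine mul_le_mul_of_nonneg_left ?_ hs
  have h := abs_dist_sub_le x y x₀
  have h2 : ρ - dist x x₀ - (ρ - dist y x₀) = -(dist x x₀ - dist y x₀) := by ring
  rwa [h2, abs_neg]

/-- Summation by parts. -/
theorem sum_sum_mul_sub_mul_sub (hD : IsDiffusive C K δ M N) (W : Finset (ZLat d))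
    (g h : ZLat d → ℝ) :
    ∑ x ∈ W, ∑ y ∈ W, C x y * ((g x - g y) * (h x - h y)) =
      2 * ∑ x ∈ W, h x * ∑ y ∈ W, C x y * (g x - g y) := by
  have h1 : ∑ x ∈ W, ∑ y ∈ W, C x y * ((g x - g y) * (h x - h y)) =
      ∑ x ∈ W, ∑ y ∈ W, h x * (C x y * (g x - g y)) +
      ∑ x ∈ W, ∑ y ∈ W, h y * (C y x * (g y - g x)) := by
    rw [← Finset.sum_add_distrib]
    refine Finset.sum_congr rfl fun x _ => ?_
    rw [← Finset.sum_add_distrib]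
    refine Finset.sum_congr rfl fun y _ => ?_
    rw [hD.symm y x]; ring
  rw [h1, Finset.sum_comm (f := fun x y => h y * (C y x * (g y - g x)))]
  simp only [← Finset.mul_sum]
  ring

theorem sum_sum_le_two_mul_of_symm {α : Type*} [DecidableEq α] {W S : Finset α} (hSW : S ⊆ W)
    {F : α → α → ℝ} (hF0 : ∀ x y, 0 ≤ F x y) (hFs : ∀ x y, F x y = F y x)
    (hF : ∀ x y, x ∉ S → y ∉ S → F x y = 0) :
    ∑ x ∈ W, ∑ y ∈ W, F x y ≤ 2 * ∑ x ∈ S, ∑ y ∈ W, F x y := by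
  have h1 : ∑ x ∈ W \ S, ∑ y ∈ W, F x y ≤ ∑ x ∈ S, ∑ y ∈ W, F x y := by
    calc ∑ x ∈ W \ S, ∑ y ∈ W, F x y = ∑ x ∈ W \ S, ∑ y ∈ S, F x y := by
          refine Finset.sum_congr rfl fun x hx => (Finset.sum_subset hSW fun y _ hy => ?_).symm
          exact hF x y (Finset.mem_sdiff.1 hx).2 hy
      _ ≤ ∑ x ∈ W, ∑ y ∈ S, F x y :=
          Finset.sum_le_sum_of_subset_of_nonneg Finset.sdiff_subset
            fun _ _ _ => Finset.sum_nonneg fun _ _ => hF0 _ _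
      _ = ∑ x ∈ S, ∑ y ∈ W, F x y := by
          rw [Finset.sum_comm]
          exact Finset.sum_congr rfl fun x _ => Finset.sum_congr rfl fun y _ => hFs _ _
  rw [← Finset.sum_sdiff hSW]
  linarith

/-- The energy of a cutoff function with weights `w`: the second moment bound makes it of order
`s²`, however long the jumps are. -/
theorem sum_sum_weight_cutoff_le (hD : IsDiffusive C K δ M N) {W S : Finset (ZLat d)} (hSW : S ⊆ W)
    {ψ w : ZLat d → ℝ} {s k : ℝ} (hk : 0 ≤ k) (hψ : ∀ x ∉ S, ψ x = 0)
    (hψs : ∀ x y, |ψ x - ψ y| ≤ s * dist x y) (hw0 : ∀ x, 0 ≤ w x) (hwk : ∀ x ∈ W, w x ≤ k) :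
    ∑ x ∈ W, ∑ y ∈ W, C x y * (w x * w y * (ψ x - ψ y) ^ 2) ≤
      2 * k * s ^ 2 * K * ∑ x ∈ S, w x := by
  classical
  have h1 := sum_sum_le_two_mul_of_symm hSW (F := fun x y => C x y * (w x * w y * (ψ x - ψ y) ^ 2))
    (fun x y => mul_nonneg (hD.nonneg x y)
      (mul_nonneg (mul_nonneg (hw0 x) (hw0 y)) (sq_nonneg _)))
    (fun x y => by rw [hD.symm x y]; ring)
    (fun x y hx hy => by simp only [hψ x hx, hψ y hy]; ring)
  refine h1.trans ?_
  rw [Finset.mul_sum, Finset.mul_sum]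
  refine Finset.sum_le_sum fun x _ => ?_
  calc 2 * ∑ y ∈ W, C x y * (w x * w y * (ψ x - ψ y) ^ 2)
      ≤ 2 * ∑ y ∈ W, w x * k * s ^ 2 * (C x y * dist x y ^ 2) := by
        refine mul_le_mul_of_nonneg_left (Finset.sum_le_sum fun y hy => ?_) (by norm_num)
        have h2 : (ψ x - ψ y) ^ 2 ≤ s ^ 2 * dist x y ^ 2 := by
          rw [← mul_pow, ← sq_abs]
          exact pow_le_pow_left₀ (abs_nonneg _) (hψs x y) 2
        have h3 := hD.nonneg x y
        have h4 := hwk y hy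
        have h5 := hw0 x
        have h6 := hw0 y
        calc C x y * (w x * w y * (ψ x - ψ y) ^ 2)
            ≤ C x y * (w x * k * (s ^ 2 * dist x y ^ 2)) := by gcongr
          _ = _ := by ring
    _ = 2 * (w x * k * s ^ 2 * ∑ y ∈ W, C x y * dist x y ^ 2) := by simp only [Finset.mul_sum]
    _ ≤ 2 * (w x * k * s ^ 2 * K) := by
        have h5 := hw0 x
        gcongr
        exact hD.moment x W
    _ = _ := by ring

/-- **Caccioppoli inequality** for the negative part `(k - u)⁺` of a function `u ≥ 0` that is
superharmonic on `S` up to the error `e`. -/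
theorem energy_cutoff_mul_le (hD : IsDiffusive C K δ M N) {W S : Finset (ZLat d)} (hSW : S ⊆ W)
    {ψ u : ZLat d → ℝ} {s k e : ℝ} (hk : 0 ≤ k) (he : 0 ≤ e) (hψ : ∀ x ∉ S, ψ x = 0)
    (hψ0 : ∀ x, 0 ≤ ψ x) (hψ1 : ∀ x, ψ x ≤ 1)
    (hψs : ∀ x y, |ψ x - ψ y| ≤ s * dist x y) (hu : ∀ x ∈ W, 0 ≤ u x)
    (hsup : ∀ x ∈ S, -e ≤ ∑ y ∈ W, C x y * (u x - u y)) :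
    energy C W (fun x => ψ x * max (k - u x) 0) ≤
      (2 * e * k + 2 * k ^ 2 * s ^ 2 * K) * (S.filter fun x => u x < k).card := by
  set w : ZLat d → ℝ := fun x => max (k - u x) 0 with hw
  have hw0 : ∀ x, 0 ≤ w x := fun x => le_max_right _ _
  have hwk : ∀ x ∈ W, w x ≤ k := fun x hx => max_le (by linarith [hu x hx]) hk
  have hwu : ∀ x, k - u x ≤ w x := fun x => le_max_left _ _
  have hsum : ∑ x ∈ S, w x ≤ k * (S.filter fun x => u x < k).card := by
    rw [← Finset.sum_filter_of_ne (p := fun x => u x < k)]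
    · calc _ ≤ ∑ x ∈ S with u x < k, k :=
            Finset.sum_le_sum fun x hx => hwk x (hSW (Finset.mem_filter.1 hx).1)
        _ = _ := by simp [mul_comm]
    · intro x _ hne
      by_contra hcon
      exact hne (max_eq_right (by linarith))
  have hid : energy C W (fun x => ψ x * w x) =
      2 * ∑ x ∈ W, (ψ x ^ 2 * w x) * ∑ y ∈ W, C x y * (w x - w y) +
      ∑ x ∈ W, ∑ y ∈ W, C x y * (w x * w y * (ψ x - ψ y) ^ 2) := by
    rw [← hD.sum_sum_mul_sub_mul_sub W w (fun x => ψ x ^ 2 * w x), energy,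
      ← Finset.sum_add_distrib]
    refine Finset.sum_congr rfl fun x _ => ?_
    rw [← Finset.sum_add_distrib]
    exact Finset.sum_congr rfl fun y _ => by ring
  have h1 : ∑ x ∈ W, (ψ x ^ 2 * w x) * ∑ y ∈ W, C x y * (w x - w y) ≤ e * ∑ x ∈ S, w x := by
    rw [← Finset.sum_subset hSW (f := fun x => (ψ x ^ 2 * w x) * ∑ y ∈ W, C x y * (w x - w y))
      (fun x _ hx => by simp [hψ x hx]), Finset.mul_sum]
    refine Finset.sum_le_sum fun x hx => ?_
    rcases (hw0 x).eq_or_lt with h0 | h0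
    · simp [← h0]
    have hwx : w x = k - u x := by
      rcases max_choice (k - u x) 0 with h | h
      · exact h
      · exact absurd (show w x = 0 from h) h0.ne'
    have h2 : ∑ y ∈ W, C x y * (w x - w y) ≤ e := by
      calc ∑ y ∈ W, C x y * (w x - w y) ≤ ∑ y ∈ W, -(C x y * (u x - u y)) := by
            refine Finset.sum_le_sum fun y _ => ?_
            have := mul_le_mul_of_nonneg_left (show w x - w y ≤ -(u x - u y) by
              linarith [hwu y]) (hD.nonneg x y)
            linarith
        _ ≤ e := by rw [Finset.sum_neg_distrib]; linarith [hsup x hx]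
    have h3 : ψ x ^ 2 ≤ 1 := pow_le_one₀ (hψ0 x) (hψ1 x)
    calc (ψ x ^ 2 * w x) * ∑ y ∈ W, C x y * (w x - w y) ≤ (ψ x ^ 2 * w x) * e := by gcongr
      _ ≤ (1 * w x) * e := by gcongr
      _ = _ := by ring
  have h2 := hD.sum_sum_weight_cutoff_le hSW hk hψ hψs hw0 hwk
  have hK := hD.moment_nonneg
  rw [hid]
  calc _ ≤ 2 * (e * ∑ x ∈ S, w x) + 2 * k * s ^ 2 * K * ∑ x ∈ S, w x := by linarith
    _ = (2 * e + 2 * k * s ^ 2 * K) * ∑ x ∈ S, w x := by ring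
    _ ≤ (2 * e + 2 * k * s ^ 2 * K) * (k * (S.filter fun x => u x < k).card) := by gcongr
    _ = _ := by ring

/-- **Logarithmic Caccioppoli inequality**: the equation for `U > 0` is tested with `ψ² / U`. -/
theorem sum_div_add_sum_log_le (hD : IsDiffusive C K δ M N) {W S T : Finset (ZLat d)} (hSW : S ⊆ W)
    (hTW : T ⊆ W) {ψ U : ZLat d → ℝ} {s : ℝ} (hψ : ∀ x ∉ S, ψ x = 0) (hψT : ∀ x ∈ T, ψ x = 1)
    (hψs : ∀ x y, |ψ x - ψ y| ≤ s * dist x y) (hU : ∀ x ∈ W, 0 < U x) :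
    2 * ∑ x ∈ S, ψ x ^ 2 / U x * ∑ y ∈ W, C x y * (U x - U y) +
      ∑ x ∈ T, ∑ y ∈ T, C x y * ((U x - U y) ^ 2 / (U x * U y)) ≤ 2 * s ^ 2 * K * S.card := by
  classical
  have h1 : energy C W ψ ≤ 2 * s ^ 2 * K * S.card := by
    have := hD.sum_sum_weight_cutoff_le hSW (w := fun _ => 1) zero_le_one hψ hψs
      (fun _ => zero_le_one) (fun _ _ => le_rfl)
    simpa [energy] using this
  rw [Finset.sum_subset hSW (f := fun x => ψ x ^ 2 / U x * ∑ y ∈ W, C x y * (U x - U y))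
      (fun x _ hx => by simp [hψ x hx]), ← hD.sum_sum_mul_sub_mul_sub W U (fun x => ψ x ^ 2 / U x)]
  refine le_trans ?_ h1
  set F : ZLat d → ZLat d → ℝ := fun x y => C x y *
    ((ψ x - ψ y) ^ 2 - (U x - U y) * (ψ x ^ 2 / U x - ψ y ^ 2 / U y)) with hF
  have hF0 : ∀ x ∈ W, ∀ y ∈ W, 0 ≤ F x y := fun x hx y hy =>
    mul_nonneg (hD.nonneg x y) (sub_nonneg.2 (sub_mul_div_sub_div_le (hU x hx) (hU y hy) _ _))
  have h2 : ∑ x ∈ T, ∑ y ∈ T, C x y * ((U x - U y) ^ 2 / (U x * U y)) ≤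
      ∑ x ∈ W, ∑ y ∈ W, F x y := by
    calc _ = ∑ x ∈ T, ∑ y ∈ T, F x y := by
          refine Finset.sum_congr rfl fun x hx => Finset.sum_congr rfl fun y hy => ?_
          have hx' := hU x (hTW hx)
          have hy' := hU y (hTW hy)
          simp only [hF, hψT x hx, hψT y hy]
          field_simp
          ring
      _ ≤ ∑ x ∈ T, ∑ y ∈ W, F x y := Finset.sum_le_sum fun x hx =>
          Finset.sum_le_sum_of_subset_of_nonneg hTW fun y hy _ => hF0 x (hTW hx) y hy
      _ ≤ _ := Finset.sum_le_sum_of_subset_of_nonneg hTW fun x hx _ =>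
          Finset.sum_nonneg fun y hy => hF0 x hx y hy
  have h3 : ∑ x ∈ W, ∑ y ∈ W, F x y = energy C W ψ -
      ∑ x ∈ W, ∑ y ∈ W, C x y * ((U x - U y) * (ψ x ^ 2 / U x - ψ y ^ 2 / U y)) := by
    rw [energy, ← Finset.sum_sub_distrib]
    refine Finset.sum_congr rfl fun x _ => ?_
    rw [← Finset.sum_sub_distrib]
    exact Finset.sum_congr rfl fun y _ => by simp only [hF]; ring
  linarith

end IsDiffusive

/-! ### The De Giorgi iteration -/

namespace IsDiffusive

variable {d : ℕ} {C : ZLat d → ZLat d → ℝ} {K δ M : ℝ} {N : ℕ}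

open ZLat

/-- The De Giorgi iteration. If a nonnegative `u`, superharmonic up to an error `a / R²`, is below
`2a` on a sufficiently small proportion of a cube, then it is at least `a` on the half cube: the
sets `{u < a(1 + 2⁻ʲ)}` in the cubes of radius `R(1 + 2⁻ʲ)` have at most `(τ R 4⁻ʲ)ᵈ` points,
which is eventually less than one point. -/
theorem exists_deGiorgi (hD : IsDiffusive C K δ M N) (hd : 0 < d) :
    ∃ τ : ℝ, 0 < τ ∧ ∀ (x₀ : ZLat d) (R : ℕ), 0 < R → ∀ (W : Finset (ZLat d)) (u : ZLat d → ℝ)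
      (a : ℝ), 0 < a → box x₀ ((3 + ⌈M⌉₊) * R) ⊆ W → (∀ x ∈ W, 0 ≤ u x) →
      (∀ x ∈ box x₀ (2 * R), -(a / R ^ 2) ≤ ∑ y ∈ W, C x y * (u x - u y)) →
      (((box x₀ (2 * R)).filter fun x => u x < 2 * a).card : ℝ) ≤ (τ * R) ^ d →
      ∀ x ∈ box x₀ R, a ≤ u x := by
  classical
  obtain ⟨A, hA0, hA⟩ := hD.exists_faberKrahn
  have hK := hD.moment_nonneg
  -- One step multiplies the number of points by at most `B τ²`, and `τ` is chosen such that this is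
  -- at most `4⁻ᵈ`.
  set B : ℝ := 36 * A * (4 + 32 * K) with hB
  have hB0 : 0 ≤ B := by positivity
  set τ : ℝ := 1 / (2 ^ d * (B + 1)) with hτ
  have hτ0 : 0 < τ := by positivity
  have hτB : B * τ ^ 2 ≤ (1 / 4) ^ d := by
    have h1 : B * τ ^ 2 = (1 / 4) ^ d * (B / (B + 1) ^ 2) := by
      have h4 : (4 : ℝ) ^ d = 2 ^ d * 2 ^ d := by rw [← mul_pow]; norm_num
      rw [hτ, div_pow, div_pow, one_pow, one_pow, h4]; field_simp
    have h2 : B / (B + 1) ^ 2 ≤ 1 := by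
      rw [div_le_one (by positivity)]; nlinarith
    rw [h1]
    exact mul_le_of_le_one_right (by positivity) h2
  refine ⟨τ, hτ0, fun x₀ R hR W u a ha hW hu hsup hsmall => ?_⟩
  have hR0 : (0 : ℝ) < R := by exact_mod_cast hR
  set Q : ℕ → ℝ := fun j => 1 + (1 / 2) ^ j with hQ
  have hQ2 : ∀ j, Q j ≤ 2 := fun j => by
    have : ((1 : ℝ) / 2) ^ j ≤ 1 := pow_le_one₀ (by norm_num) (by norm_num)
    simp only [hQ]; linarith
  have hQ1 : ∀ j, 1 ≤ Q j := fun j => by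
    have : (0 : ℝ) ≤ (1 / 2) ^ j := by positivity
    simp only [hQ]; linarith
  have hQs : ∀ j, Q j - Q (j + 1) = (1 / 2) ^ (j + 1) := fun j => by
    simp only [hQ, pow_succ]; ring
  have hQm : ∀ j, Q (j + 1) ≤ Q j := fun j => by
    have : (0 : ℝ) ≤ (1 / 2) ^ (j + 1) := by positivity
    linarith [hQs j]
  let D : ℕ → Finset (ZLat d) := fun j => (box x₀ (2 * R)).filter fun x => dist x x₀ < R * Q j
  let E : ℕ → Finset (ZLat d) := fun j => (D j).filter fun x => u x < a * Q j
  have hE : ∀ j x, x ∈ E j ↔ (x ∈ box x₀ (2 * R) ∧ dist x x₀ < R * Q j) ∧ u x < a * Q j := by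
    intro j x; simp [E, D]
  have hDbox : ∀ j, D j ⊆ box x₀ (2 * R) := fun j => Finset.filter_subset _ _
  have hsubW : ∀ y ∈ box x₀ (2 * R), box y (⌈M⌉₊ + 1) ⊆ W := by
    intro y hy
    refine (box_subset_box (by omega) ?_).trans hW
    rw [mem_box (by omega)] at hy
    have hR1 : (1 : ℝ) ≤ R := by exact_mod_cast hR
    have h2 : (⌈M⌉₊ : ℝ) ≤ ⌈M⌉₊ * R := by nlinarith [Nat.cast_nonneg (α := ℝ) ⌈M⌉₊]
    push_cast at hy ⊢
    linarith
  have hDW : ∀ j, D j ⊆ W := fun j x hx => hsubW x (hDbox j hx) (self_mem_box x (by omega))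
  have hmono : ∀ j, E (j + 1) ⊆ E j := by
    intro j x hx
    rw [hE] at hx ⊢
    refine ⟨⟨hx.1.1, hx.1.2.trans_le ?_⟩, hx.2.trans_le ?_⟩
    · exact mul_le_mul_of_nonneg_left (hQm j) hR0.le
    · exact mul_le_mul_of_nonneg_left (hQm j) ha.le
  have hclaim : ∀ j, ((E j).card : ℝ) ≤ (τ * R * (1 / 4) ^ j) ^ d := by
    intro j
    induction j with
    | zero =>
      simp only [pow_zero, mul_one]
      refine le_trans (Nat.cast_le.2 (Finset.card_le_card fun x hx => ?_)) hsmall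
      rw [hE] at hx
      refine Finset.mem_filter.2 ⟨hx.1.1, ?_⟩
      have := hx.2
      simp only [hQ, pow_zero] at this
      linarith
    | succ j ih =>
      rcases Nat.eq_zero_or_pos (E j).card with h0 | h0
      · have : E (j + 1) = ∅ := by
          rw [Finset.card_eq_zero] at h0
          exact Finset.subset_empty.1 (h0 ▸ hmono j)
        rw [this]
        simp only [Finset.card_empty, Nat.cast_zero]
        positivity
      set t : ℝ := τ * R * (1 / 4) ^ j with ht
      have ht0 : 0 < t := by positivity
      have ht1 : 1 ≤ t := by
        by_contra hcon
        have h1 : t ^ d < 1 := pow_lt_one₀ ht0.le (not_le.1 hcon) hd.ne'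
        have h2 : (1 : ℝ) ≤ (E j).card := by exact_mod_cast h0
        linarith
      -- The Faber–Krahn scale; as `t ≥ 1`, rounding up costs only a constant factor.
      set ℓ : ℕ := ⌈2 * t⌉₊ with hℓ
      have hℓ1 : 2 * t ≤ ℓ := Nat.le_ceil _
      have hℓ2 : (ℓ : ℝ) ≤ 3 * t := by
        have := (Nat.ceil_lt_add_one (show 0 ≤ 2 * t by positivity)).le
        linarith
      have hcard : 2 * (E j).card ≤ ℓ ^ d := by
        have h1 : (2 : ℝ) * (E j).card ≤ (ℓ : ℝ) ^ d := by
          have h2 : (2 : ℝ) ≤ 2 ^ d := by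
            simpa using pow_le_pow_right₀ (show (1 : ℝ) ≤ 2 by norm_num) (show 1 ≤ d from hd)
          calc (2 : ℝ) * (E j).card ≤ 2 ^ d * t ^ d := by gcongr
            _ = (2 * t) ^ d := (mul_pow 2 t d).symm
            _ ≤ _ := by gcongr
        exact_mod_cast h1
      set s : ℝ := 2 ^ (j + 1) / R with hs
      have hs0 : 0 ≤ s := by positivity
      set ψ := cutoff x₀ (R * Q j) s with hψdef
      have hψ : ∀ x ∉ D j, ψ x = 0 := by
        intro x hx
        refine cutoff_eq_zero hs0 ?_
        by_contra hcon
        refine hx (Finset.mem_filter.2 ⟨(mem_box (by omega)).2 ?_, not_le.1 hcon⟩)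
        push_cast
        nlinarith [hQ2 j, not_le.1 hcon]
      set f : ZLat d → ℝ := fun x => ψ x * max (a * Q j - u x) 0 with hf
      have hf0 : ∀ x ∉ E j, f x = 0 := by
        intro x hx
        by_cases hxD : x ∈ D j
        · have : ¬ u x < a * Q j := fun h => hx (Finset.mem_filter.2 ⟨hxD, h⟩)
          simp only [hf]
          rw [max_eq_right (by linarith), mul_zero]
        · simp only [hf, hψ x hxD, zero_mul]
      have hen : energy C W f ≤ (2 * (a / R ^ 2) * (a * Q j) + 2 * (a * Q j) ^ 2 * s ^ 2 * K) *
          (E j).card :=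
        hD.energy_cutoff_mul_le (hDW j) (mul_nonneg ha.le (by linarith [hQ1 j])) (by positivity) hψ
          (cutoff_nonneg _ _ _) (cutoff_le_one _ _ _) (abs_cutoff_sub_le x₀ hs0) hu
          fun x hx => hsup x (hDbox j hx)
      have hen' : energy C W f ≤ (4 + 32 * K) * 4 ^ j * a ^ 2 / R ^ 2 * (E j).card := by
        refine hen.trans (mul_le_mul_of_nonneg_right ?_ (Nat.cast_nonneg _))
        have h4 : (1 : ℝ) ≤ 4 ^ j := one_le_pow₀ (by norm_num)
        have hss : s ^ 2 = 4 * 4 ^ j / R ^ 2 := by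
          rw [hs, div_pow, ← pow_mul, mul_comm (j + 1) 2, pow_mul, pow_succ]; norm_num; ring
        have hq0 : 0 ≤ Q j := by linarith [hQ1 j]
        calc 2 * (a / R ^ 2) * (a * Q j) + 2 * (a * Q j) ^ 2 * s ^ 2 * K
            ≤ 2 * (a / R ^ 2) * (a * 2) * 4 ^ j + 2 * (a * 2) ^ 2 * s ^ 2 * K := by
              refine add_le_add ?_ ?_
              · calc 2 * (a / R ^ 2) * (a * Q j) ≤ 2 * (a / R ^ 2) * (a * 2) := by
                      have := hQ2 j
                      gcongr
                  _ ≤ _ := le_mul_of_one_le_right (by positivity) h4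
              · have := hQ2 j
                gcongr
          _ = _ := by rw [hss]; ring
      have hFK := hA W (E j) f ℓ (Nat.ceil_pos.2 (by positivity)) hf0
        (fun y hy => hsubW y (hDbox j (Finset.filter_subset _ _ hy))) hcard
      have hlow : a ^ 2 / (4 * 4 ^ j) * (E (j + 1)).card ≤ ∑ x ∈ E j, f x ^ 2 := by
        calc a ^ 2 / (4 * 4 ^ j) * (E (j + 1)).card = ∑ x ∈ E (j + 1), a ^ 2 / (4 * 4 ^ j) := by
              rw [Finset.sum_const, nsmul_eq_mul, mul_comm]
          _ ≤ ∑ x ∈ E (j + 1), f x ^ 2 := by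
              refine Finset.sum_le_sum fun x hx => ?_
              rw [hE] at hx
              have hψ1 : ψ x = 1 := by
                refine cutoff_eq_one ?_
                have h1 : R * (1 / 2) ^ (j + 1) ≤ R * Q j - dist x x₀ := by
                  rw [← hQs j]; linarith [hx.1.2]
                calc (1 : ℝ) = s * (R * (1 / 2) ^ (j + 1)) := by
                      rw [hs, one_div_pow]; field_simp
                  _ ≤ _ := by gcongr
              have h2 : a * (1 / 2) ^ (j + 1) ≤ f x := by
                simp only [hf, hψ1, one_mul]
                refine le_max_of_le_left ?_
                rw [← hQs j]; linarith [hx.2]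
              calc a ^ 2 / (4 * 4 ^ j) = (a * (1 / 2) ^ (j + 1)) ^ 2 := by
                    have h3 : ((1 / 2 : ℝ) ^ (j + 1)) ^ 2 = 1 / (4 * 4 ^ j) := by
                      calc ((1 / 2 : ℝ) ^ (j + 1)) ^ 2 = ((1 / 2) ^ 2) ^ (j + 1) := by
                            rw [← pow_mul, mul_comm, pow_mul]
                        _ = (1 / 4) ^ (j + 1) := by norm_num
                        _ = _ := by rw [one_div_pow, pow_succ, mul_comm]
                    rw [mul_pow, h3]; ring
                _ ≤ _ := pow_le_pow_left₀ (by positivity) h2 2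
          _ ≤ _ := Finset.sum_le_sum_of_subset_of_nonneg (hmono j) fun _ _ _ => sq_nonneg _
      have hmain : a ^ 2 / (4 * 4 ^ j) * (E (j + 1)).card ≤
          a ^ 2 / (4 * 4 ^ j) * ((1 / 4) ^ d * (E j).card) := by
        calc _ ≤ A * ℓ ^ 2 * energy C W f := hlow.trans hFK
          _ ≤ A * (3 * t) ^ 2 * ((4 + 32 * K) * 4 ^ j * a ^ 2 / R ^ 2 * (E j).card) := by
              have := hD.energy_nonneg W f
              gcongr
          _ = a ^ 2 / (4 * 4 ^ j) * (B * τ ^ 2 * (E j).card) := by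
              have h44 : ((1 / 4 : ℝ) ^ j) * 4 ^ j = 1 := by rw [← mul_pow]; norm_num
              have h16 : (4 : ℝ) ^ j ≠ 0 := by positivity
              rw [ht, hB, one_div_pow]
              field_simp
              ring
          _ ≤ _ := by gcongr
      have hpos : 0 < a ^ 2 / (4 * 4 ^ j) := by positivity
      have h5 := le_of_mul_le_mul_left hmain hpos
      calc ((E (j + 1)).card : ℝ) ≤ (1 / 4) ^ d * (E j).card := h5
        _ ≤ (1 / 4) ^ d * t ^ d := by gcongr
        _ = _ := by rw [← mul_pow, ht, pow_succ]; ring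
  intro x hx
  by_contra hcon
  rw [not_le] at hcon
  obtain ⟨j, hj⟩ := exists_pow_lt_of_lt_one (show 0 < 1 / (τ * R) by positivity)
    (show (1 / 4 : ℝ) < 1 by norm_num)
  rw [lt_div_iff₀' (by positivity)] at hj
  have h1 := (hclaim j).trans_lt (pow_lt_one₀ (by positivity) hj hd.ne')
  have h2 : (E j).card = 0 := by
    have : (E j).card < 1 := by exact_mod_cast h1
    omega
  rw [Finset.card_eq_zero] at h2
  have h3 : x ∈ E j := by
    rw [hE]
    refine ⟨⟨box_subset_box hR (by rw [dist_self]; push_cast; linarith) hx, ?_⟩, ?_⟩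
    · rw [mem_box hR] at hx
      exact hx.trans_le (le_mul_of_one_le_right hR0.le (hQ1 j))
    · exact hcon.trans_le (le_mul_of_one_le_right ha.le (hQ1 j))
  rw [h2] at h3
  simp at h3

end IsDiffusive

/-! ### The growth lemma -/

namespace IsDiffusive

variable {d : ℕ} {C : ZLat d → ZLat d → ℝ} {K δ M : ℝ} {N : ℕ}

open ZLat

theorem sq_max_neg_log_sub_le {a b : ℝ} (ha : 0 < a) (hb : 0 < b) :
    (max (-Real.log a) 0 - max (-Real.log b) 0) ^ 2 ≤ 4 * ((a - b) ^ 2 / (a * b)) := by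
  refine le_trans ?_ (sq_log_sub_log_le ha hb)
  rw [← sq_abs, ← sq_abs (Real.log a - Real.log b)]
  refine pow_le_pow_left₀ (abs_nonneg _) ((abs_max_sub_max_le_max _ _ _ _).trans ?_) 2
  rw [sub_self, abs_zero, max_eq_left (abs_nonneg _), ← abs_neg]
  exact le_of_eq (by congr 1; ring)

/-- **Growth lemma.** A nonnegative function, superharmonic up to a small error, that is at least
`1` on a third of a cube of radius `r` is bounded below on the cube of radius `2r`. The logarithmic
Caccioppoli and Poincaré inequalities show that `u` is small only on a small proportion
of a larger cube, so that the De Giorgi iteration applies. -/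
theorem exists_growth (hD : IsDiffusive C K δ M N) (hd : 0 < d) :
    ∃ (Λ : ℕ) (c ε : ℝ), 2 ≤ Λ ∧ 0 < c ∧ 0 < ε ∧ ∀ (x₀ : ZLat d) (r : ℕ), 0 < r →
      ∀ (W : Finset (ZLat d)) (u : ZLat d → ℝ), box x₀ (Λ * r) ⊆ W → (∀ x ∈ W, 0 ≤ u x) →
      (∀ x ∈ box x₀ (Λ * r), -(ε / r ^ 2) ≤ ∑ y ∈ W, C x y * (u x - u y)) →
      (box x₀ r).card ≤ 3 * ((box x₀ r).filter fun x => 1 ≤ u x).card →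
      ∀ x ∈ box x₀ (2 * r), c ≤ u x := by
  classical
  obtain ⟨A, hA0, hA⟩ := hD.exists_poincare
  obtain ⟨τ, hτ0, hτ⟩ := hD.exists_deGiorgi hd
  have hK := hD.moment_nonneg
  have hM := hD.ceil_pos
  set L : ℕ := 9 + ⌈M⌉₊ with hL
  set P : ℝ := A * (4 * (2 * K + 2) * (2 * (2 * L)) ^ d) with hP
  have hP0 : 0 ≤ P := by positivity
  -- `P` bounds `∑ v² / rᵈ` for `v = (log 1/(u + a))⁺`, independently of `a`; so `v ≥ k` on a small
  -- proportion only, and `a` is chosen such that this holds where `u < 2a`.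
  set k : ℝ := 1 + P / (2 * τ) ^ d with hk
  have hk1 : 1 ≤ k := by
    have : 0 ≤ P / (2 * τ) ^ d := by positivity
    linarith
  have hPk : P ≤ (2 * τ) ^ d * k ^ 2 := by
    have h1 : P = (2 * τ) ^ d * (P / (2 * τ) ^ d) := by field_simp
    rw [h1]
    gcongr
    nlinarith
  set a : ℝ := Real.exp (-k) / 3 with ha
  have ha0 : 0 < a := by positivity
  refine ⟨2 * L, a, a / 4, by omega, ha0, by positivity,
    fun x₀ r hr W u hW hu hsup hfrac => ?_⟩
  have hr0 : (0 : ℝ) < r := by exact_mod_cast hr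
  have hL1 : (1 : ℝ) ≤ L := by rw [hL]; push_cast; linarith [Nat.cast_nonneg (α := ℝ) ⌈M⌉₊]
  have hLr : 0 < L * r := by positivity
  have hLr2 : 0 < 2 * L * r := by positivity
  set T := box x₀ (L * r) with hT
  set S := box x₀ (2 * L * r) with hS
  have hTS : T ⊆ S := box_subset_box hLr (by
    rw [dist_self]; push_cast; nlinarith [mul_pos (zero_lt_one.trans_le hL1) hr0])
  have hTW : T ⊆ W := hTS.trans hW
  set U : ZLat d → ℝ := fun x => u x + a with hU
  have hUa : ∀ x ∈ W, a ≤ U x := fun x hx => by simp only [hU]; linarith [hu x hx]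
  have hUpos : ∀ x ∈ W, 0 < U x := fun x hx => ha0.trans_le (hUa x hx)
  set s : ℝ := 1 / (L * r) with hs
  have hs0 : 0 ≤ s := by positivity
  set ψ := cutoff x₀ ((2 * L * r : ℕ) : ℝ) s with hψdef
  have hlog := hD.sum_div_add_sum_log_le hW hTW (ψ := ψ) (U := U) (s := s)
    (fun x hx => cutoff_eq_zero hs0 (by
      by_contra hcon
      exact hx ((mem_box hLr2).2 (not_le.1 hcon))))
    (fun x hx => cutoff_eq_one (by
      rw [hT, mem_box hLr] at hx
      push_cast at hx ⊢
      rw [hs, one_div, ← div_eq_inv_mul, one_le_div (by positivity)]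
      linarith))
    (abs_cutoff_sub_le x₀ hs0) hUpos
  have hcardS : (S.card : ℝ) ≤ (2 * (2 * L)) ^ d * r ^ d := by
    refine (card_box_le x₀ hLr2).trans (le_of_eq ?_)
    rw [← mul_pow]; push_cast; ring
  have hfirst : -(1 / r ^ 2 * S.card) ≤
      ∑ x ∈ S, ψ x ^ 2 / U x * ∑ y ∈ W, C x y * (U x - U y) := by
    rw [mul_comm, ← nsmul_eq_mul, ← Finset.sum_const, ← Finset.sum_neg_distrib]
    refine Finset.sum_le_sum fun x hx => ?_
    have h1 : ∑ y ∈ W, C x y * (U x - U y) = ∑ y ∈ W, C x y * (u x - u y) :=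
      Finset.sum_congr rfl fun y _ => by simp only [hU]; ring
    have hUx := hUpos x (hW hx)
    have h2 : ψ x ^ 2 / U x ≤ 1 / a := by
      have h3 : ψ x ^ 2 ≤ 1 := pow_le_one₀ (cutoff_nonneg _ _ _ _) (cutoff_le_one _ _ _ _)
      exact div_le_div₀ zero_le_one h3 ha0 (hUa x (hW hx))
    have h4 : 0 ≤ ψ x ^ 2 / U x := by positivity
    rw [h1]
    calc -(1 / (r : ℝ) ^ 2) ≤ -(1 / a * (a / 4 / r ^ 2)) := by
          rw [neg_le_neg_iff]
          have : 1 / a * (a / 4 / (r : ℝ) ^ 2) = 1 / 4 * (1 / r ^ 2) := by field_simp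
          rw [this]
          have : 0 ≤ 1 / (r : ℝ) ^ 2 := by positivity
          linarith
      _ ≤ -(ψ x ^ 2 / U x * (a / 4 / r ^ 2)) := by
          rw [neg_le_neg_iff]; gcongr
      _ = ψ x ^ 2 / U x * (-(a / 4 / r ^ 2)) := by ring
      _ ≤ _ := mul_le_mul_of_nonneg_left (hsup x hx) h4
  set v : ZLat d → ℝ := fun x => max (-Real.log (U x)) 0 with hv
  have hen : energy C T v ≤ 4 * (2 * K + 2) * (2 * (2 * L)) ^ d * r ^ d / r ^ 2 := by
    calc energy C T v ≤ ∑ x ∈ T, ∑ y ∈ T, 4 * (C x y * ((U x - U y) ^ 2 / (U x * U y))) := by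
          refine Finset.sum_le_sum fun x hx => Finset.sum_le_sum fun y hy => ?_
          have := mul_le_mul_of_nonneg_left
            (sq_max_neg_log_sub_le (hUpos x (hTW hx)) (hUpos y (hTW hy))) (hD.nonneg x y)
          linarith
      _ = 4 * ∑ x ∈ T, ∑ y ∈ T, C x y * ((U x - U y) ^ 2 / (U x * U y)) := by
          simp only [Finset.mul_sum]
      _ ≤ 4 * (2 * s ^ 2 * K * S.card + 2 * (1 / r ^ 2 * S.card)) := by linarith
      _ ≤ 4 * (2 * (1 / r ^ 2) * K * S.card + 2 * (1 / r ^ 2 * S.card)) := by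
          have : s ^ 2 ≤ 1 / r ^ 2 := by
            rw [hs, div_pow, one_pow, mul_pow]
            refine one_div_le_one_div_of_le (by positivity) ?_
            exact le_mul_of_one_le_left (by positivity) (one_le_pow₀ hL1)
          gcongr
      _ = 4 * (2 * K + 2) * S.card / r ^ 2 := by ring
      _ ≤ 4 * (2 * K + 2) * ((2 * (2 * L)) ^ d * r ^ d) / r ^ 2 := by gcongr
      _ = _ := by ring
  have hpoin := hA x₀ r hr T ((box x₀ r).filter fun x => 1 ≤ u x) v subset_rfl
    (Finset.filter_subset _ _) hfrac (fun z hz => by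
      have h1 := (Finset.mem_filter.1 hz).2
      refine max_eq_right (neg_nonpos.2 (Real.log_nonneg ?_))
      simp only [hU]; linarith)
  have hsum : ∑ x ∈ box x₀ (4 * r), v x ^ 2 ≤ P * r ^ d := by
    refine hpoin.trans ?_
    calc A * r ^ 2 * energy C T v
        ≤ A * r ^ 2 * (4 * (2 * K + 2) * (2 * (2 * L)) ^ d * r ^ d / r ^ 2) := by gcongr
      _ = _ := by rw [hP]; field_simp
  have hsmall : (((box x₀ (2 * (2 * r))).filter fun x => u x < 2 * a).card : ℝ) ≤
      (τ * (2 * r : ℕ)) ^ d := by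
    have h42 : 2 * (2 * r) = 4 * r := by ring
    rw [h42]
    set E := (box x₀ (4 * r)).filter fun x => u x < 2 * a
    have hEW : ∀ x ∈ E, x ∈ W := fun x hx => hTW (box_subset_box (by omega) (by
      rw [dist_self]; push_cast [hL]
      have : (0 : ℝ) ≤ ⌈M⌉₊ * r := by positivity
      linarith) (Finset.mem_filter.1 hx).1)
    have h1 : (E.card : ℝ) * k ^ 2 ≤ P * r ^ d := by
      calc (E.card : ℝ) * k ^ 2 = ∑ x ∈ E, k ^ 2 := by rw [Finset.sum_const, nsmul_eq_mul]
        _ ≤ ∑ x ∈ E, v x ^ 2 := by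
            refine Finset.sum_le_sum fun x hx => pow_le_pow_left₀ (by linarith) ?_ 2
            refine le_max_of_le_left ?_
            have hux := (Finset.mem_filter.1 hx).2
            have h2 : U x ≤ Real.exp (-k) := by
              simp only [hU]
              have : Real.exp (-k) = 3 * a := by rw [ha]; ring
              linarith
            have h3 := Real.log_le_log (hUpos x (hEW x hx)) h2
            rw [Real.log_exp] at h3
            linarith
        _ ≤ ∑ x ∈ box x₀ (4 * r), v x ^ 2 :=
            Finset.sum_le_sum_of_subset_of_nonneg (Finset.filter_subset _ _)
              fun _ _ _ => sq_nonneg _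
        _ ≤ _ := hsum
    have h2 : (E.card : ℝ) * k ^ 2 ≤ (τ * (2 * r : ℕ)) ^ d * k ^ 2 := by
      calc (E.card : ℝ) * k ^ 2 ≤ P * r ^ d := h1
        _ ≤ (2 * τ) ^ d * k ^ 2 * r ^ d := by gcongr
        _ = (2 * τ * r) ^ d * k ^ 2 := by rw [mul_pow (2 * τ)]; ring
        _ = _ := by push_cast; ring
    exact le_of_mul_le_mul_right h2 (by positivity)
  refine hτ x₀ (2 * r) (by omega) W u a ha0 (Finset.Subset.trans (box_subset_box (by positivity) ?_) hW)
    hu (fun x hx => ?_) hsmall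
  · rw [dist_self]; push_cast [hL]
    have : (0 : ℝ) ≤ ⌈M⌉₊ * r := by positivity
    nlinarith
  · have h1 : x ∈ S := box_subset_box (by omega) (by
      rw [dist_self]; push_cast [hL]
      have : (0 : ℝ) ≤ ⌈M⌉₊ * r := by positivity
      nlinarith) hx
    refine le_trans (le_of_eq ?_) (hsup x h1)
    push_cast
    field_simp
    norm_num

end IsDiffusive

/-! ### Harmonic functions and expansion of positivity -/

namespace IsConductance

variable {d : ℕ} {C : ZLat d → ZLat d → ℝ} {K δ M : ℝ} {N : ℕ}

open ZLat

/-- The contribution `∑_{y ∉ W} C_{xy} h(y)` of the jumps from `x` out of the finite set `W`. -/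
noncomputable def farSum (C : ZLat d → ZLat d → ℝ) (W : Finset (ZLat d)) (h : ZLat d → ℝ)
    (x : ZLat d) : ℝ :=
  ∑' y : ((W : Set (ZLat d))ᶜ : Set (ZLat d)), C x y * h y

theorem farSum_nonneg (hC : IsConductance C) (W : Finset (ZLat d)) {h : ZLat d → ℝ}
    (hh : ∀ z, 0 ≤ h z) (x : ZLat d) : 0 ≤ farSum C W h x :=
  tsum_nonneg fun y => mul_nonneg (hC.nonneg x y) (hh y)

theorem HarmonicOn.hasSum (h1 : A1 C) {h : ZLat d → ℝ} {A : Set (ZLat d)} (hh : HarmonicOn C h A)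
    {x : ZLat d} (hx : x ∈ A) : HasSum (fun y => C x y * h y) (nu C x * h x) := by
  obtain ⟨c₁, c₂, hc₁, -, hA⟩ := h1
  have hν : nu C x ≠ 0 := (hc₁.trans_le (hA x).2.1).ne'
  have h2 : (fun y => C x y * h y) = fun y => nu C x * (h y * stepProb C x y) := by
    funext y
    unfold stepProb
    field_simp
  rw [h2]
  exact (hh x hx).mul_left (nu C x)

/-- For a harmonic function, the operator restricted to a finite set `W` differs from zero by what
the jumps out of `W` bring in. -/
theorem HarmonicOn.sum_mul_sub (h1 : A1 C) {h : ZLat d → ℝ} {A : Set (ZLat d)}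
    (hh : HarmonicOn C h A) {x : ZLat d} (hx : x ∈ A) (W : Finset (ZLat d)) :
    ∑ y ∈ W, C x y * (h x - h y) = farSum C W h x - farSum C W (fun _ => 1) x * h x := by
  have hs := hh.hasSum h1 hx
  have e1 := hs.summable.sum_add_tsum_compl (s := W)
  rw [hs.tsum_eq] at e1
  obtain ⟨c₁, c₂, -, -, hA⟩ := h1
  have e2 := (hA x).1.sum_add_tsum_compl (s := W)
  have e3 : ∑ y ∈ W, C x y * (h x - h y) = (∑ y ∈ W, C x y) * h x - ∑ y ∈ W, C x y * h y := by
    rw [Finset.sum_mul, ← Finset.sum_sub_distrib]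
    exact Finset.sum_congr rfl fun y _ => by ring
  have e4 : nu C x = ∑' y, C x y := rfl
  rw [e3]
  simp only [farSum, mul_one]
  rw [e4, ← e2] at e1
  linarith

theorem farSum_one_le (hD : IsDiffusive C K δ M N) {W : Finset (ZLat d)} {x : ZLat d} {r : ℕ}
    (hr : 0 < r) (hW : box x r ⊆ W) : farSum C W (fun _ => 1) x ≤ K / r ^ 2 := by
  have hr0 : (0 : ℝ) < r := by exact_mod_cast hr
  have hK := hD.moment_nonneg
  refine Real.tsum_le_of_sum_le (fun y => by simpa using hD.nonneg x y) fun t => ?_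
  rw [le_div_iff₀ (by positivity), Finset.sum_mul]
  calc ∑ y ∈ t, C x y * 1 * (r : ℝ) ^ 2 ≤ ∑ y ∈ t, C x y * dist x (y : ZLat d) ^ 2 := by
        refine Finset.sum_le_sum fun y _ => ?_
        have h1 : (r : ℝ) ≤ dist x (y : ZLat d) := by
          by_contra hcon
          refine y.2 (hW ((mem_box hr).2 ?_))
          rw [dist_comm]; exact not_le.1 hcon
        have := hD.nonneg x y
        rw [mul_one]
        gcongr
    _ = ∑ y ∈ t.map (Function.Embedding.subtype _), C x y * dist x y ^ 2 := by
        rw [Finset.sum_map]; rfl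
    _ ≤ K := hD.moment x _

/-- Far away, (A4) makes the jump rates from nearby points comparable. -/
theorem farSum_le (hC : IsConductance C) (h1 : A1 C) {c : ℝ}
    (hc : ∀ x y y' : ZLat d, eDist y y' ≤ eDist x y / 3 → C x y ≤ c * C x y')
    {h : ZLat d → ℝ} (hh0 : ∀ z, 0 ≤ h z) {A : Set (ZLat d)}
    (hh : HarmonicOn C h A) {w w' : ZLat d} (hw : w ∈ A) (hw' : w' ∈ A) {W : Finset (ZLat d)}
    (hW : ∀ y ∉ W, eDist w w' ≤ eDist y w / 3) : farSum C W h w ≤ c * farSum C W h w' := by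
  unfold farSum
  rw [← tsum_mul_left]
  refine Summable.tsum_le_tsum (fun y => ?_) ((hh.hasSum h1 hw).summable.subtype _)
    (((hh.hasSum h1 hw').summable.subtype _).mul_left c)
  have h2 : C w y ≤ c * C w' y := by
    rw [hC.symm w, hC.symm w']
    exact hc y w w' (hW y y.2)
  calc C w y * h y ≤ c * C w' y * h y := mul_le_mul_of_nonneg_right h2 (hh0 y)
    _ = _ := by ring

theorem exists_doubling (h1 : A1 C) (hC : IsConductance C) (hD : IsDiffusive C K δ M N)
    (hd : 0 < d) :
    ∃ (Λ : ℕ) (c : ℝ), 0 < Λ ∧ 0 < c ∧ ∀ (x : ZLat d) (r : ℕ), 0 < r → ∀ h : ZLat d → ℝ,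
      (∀ z, 0 ≤ h z) → HarmonicOn C h (box x (Λ * r)) → ∀ k : ℝ, 0 < k →
      (box x r).card ≤ 3 * ((box x r).filter fun y => k ≤ h y).card →
      ∀ y ∈ box x (2 * r), c * k ≤ h y := by
  obtain ⟨Λ, c, ε, hΛ, hc, hε, hgrow⟩ := hD.exists_growth hd
  have hK := hD.moment_nonneg
  obtain ⟨n, hn⟩ := exists_nat_gt (1 + K / ε)
  have hn1 : (1 : ℝ) < n := by
    have : 0 ≤ K / ε := by positivity
    linarith
  have hn0 : 0 < n := by
    have : (0 : ℝ) < n := by linarith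
    exact_mod_cast this
  have hKn : K ≤ ε * n ^ 2 := by
    have h2 : K / ε ≤ n ^ 2 := by nlinarith
    rw [div_le_iff₀ hε] at h2
    linarith
  refine ⟨Λ, c, by omega, hc, fun x r hr h hh0 hh k hk hcard y hy => ?_⟩
  have hr0 : (0 : ℝ) < r := by exact_mod_cast hr
  have hΛr : 0 < Λ * r := Nat.mul_pos (by omega) hr
  -- Truncation at height `k` bounds the loss from the jumps out of `W` by `k K / (n r)²`.
  set W := box x ((Λ + n) * r) with hW
  set u : ZLat d → ℝ := fun z => min (h z / k) 1 with hu
  have hfilter : ((box x r).filter fun y => 1 ≤ u y) = (box x r).filter fun y => k ≤ h y := by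
    refine Finset.filter_congr fun z _ => ?_
    simp only [hu, le_min_iff, le_refl, and_true]
    rw [one_le_div hk]
  have hu0 : ∀ z, 0 ≤ u z := fun z => le_min (div_nonneg (hh0 z) hk.le) zero_le_one
  have hmain : c ≤ u y := by
    refine hgrow x r hr W u (box_subset_box hΛr ?_) (fun z _ => hu0 z) (fun z hz => ?_)
      (by rw [hfilter]; exact hcard) y hy
    · rw [dist_self]; push_cast
      have : (0 : ℝ) ≤ n * r := by positivity
      linarith
    · rcases le_or_gt k (h z) with hkz | hkz
      · have huz : u z = 1 := min_eq_right ((one_le_div hk).2 hkz)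
        have h2 : 0 ≤ ∑ w ∈ W, C z w * (u z - u w) := by
          refine Finset.sum_nonneg fun w _ => mul_nonneg (hC.nonneg z w) ?_
          rw [huz, sub_nonneg]
          exact min_le_right _ _
        have h3 : 0 ≤ ε / (r : ℝ) ^ 2 := by positivity
        linarith
      · have huz : u z = h z / k := min_eq_left ((div_le_one hk).2 hkz.le)
        have hnr : 0 < n * r := Nat.mul_pos hn0 hr
        have hfar : farSum C W (fun _ => 1) z ≤ ε / r ^ 2 := by
          refine (farSum_one_le hD (r := n * r) hnr (box_subset_box hnr ?_)).trans ?_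
          · rw [mem_box hΛr] at hz
            push_cast at hz ⊢
            linarith
          · push_cast
            rw [div_le_div_iff₀ (by positivity) (by positivity), mul_pow]
            have : 0 ≤ (r : ℝ) ^ 2 := by positivity
            nlinarith
        have hzA : z ∈ ((box x (Λ * r) : Finset (ZLat d)) : Set (ZLat d)) := hz
        have hid := hh.sum_mul_sub h1 hzA W
        have h4 : (∑ w ∈ W, C z w * (h z - h w)) / k ≤ ∑ w ∈ W, C z w * (u z - u w) := by
          rw [Finset.sum_div]
          refine Finset.sum_le_sum fun w _ => ?_
          rw [mul_div_assoc]
          refine mul_le_mul_of_nonneg_left ?_ (hC.nonneg z w)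
          rw [huz, sub_div]
          have : u w ≤ h w / k := min_le_left _ _
          linarith
        refine le_trans ?_ h4
        rw [hid, le_div_iff₀ hk]
        have h5 := farSum_nonneg hC W hh0 z
        have h6 := farSum_nonneg hC W (h := fun _ => 1) (fun _ => zero_le_one) z
        have h7 : farSum C W (fun _ => 1) z * h z ≤ ε / r ^ 2 * k :=
          mul_le_mul hfar hkz.le (hh0 z) (by positivity)
        linarith
  have h8 : c ≤ h y / k := hmain.trans (min_le_left _ _)
  rwa [le_div_iff₀ hk] at h8

/-- Expansion of positivity with a power law, by iterated doubling. -/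
theorem exists_expansion (h1 : A1 C) (hC : IsConductance C) (hD : IsDiffusive C K δ M N)
    (hd : 0 < d) :
    ∃ (Λ γ : ℕ), 0 < Λ ∧ ∀ (x : ZLat d) (s r : ℕ), 0 < s → s ≤ r → ∀ h : ZLat d → ℝ,
      (∀ z, 0 ≤ h z) → HarmonicOn C h (box x (Λ * r)) → ∀ k : ℝ, 0 < k →
      (box x s).card ≤ 3 * ((box x s).filter fun y => k ≤ h y).card →
      ∀ y ∈ box x r, ((s : ℝ) / (2 * r)) ^ γ * k ≤ h y := by
  obtain ⟨Λ, c, hΛ, hc, hdoub⟩ := exists_doubling h1 hC hD hd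
  obtain ⟨γ, hγ⟩ := exists_pow_lt_of_lt_one hc (show (1 / 2 : ℝ) < 1 by norm_num)
  refine ⟨Λ, γ, hΛ, fun x s r hs hsr h hh0 hh k hk hcard y hy => ?_⟩
  have hiter : ∀ j : ℕ, 2 ^ j * s ≤ r → ∀ y ∈ box x (2 ^ (j + 1) * s),
      ((1 / 2 : ℝ) ^ γ) ^ (j + 1) * k ≤ h y := by
    intro j
    have hsub : ∀ j : ℕ, 2 ^ j * s ≤ r → HarmonicOn C h (box x (Λ * (2 ^ j * s))) := by
      intro j hj z hz
      refine hh z (Finset.mem_coe.2 (box_subset_box (by positivity) ?_ (Finset.mem_coe.1 hz)))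
      rw [dist_self, zero_add]
      exact_mod_cast Nat.mul_le_mul_left Λ hj
    induction j with
    | zero =>
      intro hj y hy
      have h2 := hsub 0 hj
      simp only [pow_zero, one_mul] at h2
      have := hdoub x s hs h hh0 h2 k hk hcard y (by simpa using hy)
      refine le_trans ?_ this
      simp only [zero_add, pow_one]
      gcongr
    | succ j ih =>
      intro hj y hy
      have hj' : 2 ^ j * s ≤ r := by
        refine le_trans ?_ hj
        exact Nat.mul_le_mul_right s (Nat.pow_le_pow_right (by norm_num) (by omega))
      have hfull : ((box x (2 ^ (j + 1) * s)).filter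
          fun y => ((1 / 2 : ℝ) ^ γ) ^ (j + 1) * k ≤ h y) = box x (2 ^ (j + 1) * s) :=
        Finset.filter_true_of_mem (ih hj')
      have := hdoub x (2 ^ (j + 1) * s) (by positivity) h hh0 (hsub (j + 1) hj)
        (((1 / 2 : ℝ) ^ γ) ^ (j + 1) * k) (by positivity) (by rw [hfull]; omega) y
        (by convert hy using 2; ring)
      refine le_trans ?_ this
      rw [pow_succ _ (j + 1)]
      calc ((1 / 2 : ℝ) ^ γ) ^ (j + 1) * (1 / 2) ^ γ * k
          = (1 / 2) ^ γ * (((1 / 2 : ℝ) ^ γ) ^ (j + 1) * k) := by ring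
        _ ≤ _ := by gcongr
  have hr : 0 < r := by omega
  set j := Nat.log 2 (r / s) with hj
  have hrs : r / s ≠ 0 := (Nat.div_pos hsr hs).ne'
  have hj1 : 2 ^ j * s ≤ r := by
    have := Nat.pow_log_le_self 2 hrs
    exact (Nat.le_div_iff_mul_le hs).1 this
  have hj2 : r < 2 ^ (j + 1) * s := by
    have := Nat.lt_pow_succ_log_self (b := 2) (by norm_num) (r / s)
    exact (Nat.div_lt_iff_lt_mul hs).1 this
  have := hiter j hj1 y (box_subset_box hr (by
    rw [dist_self, zero_add]; exact_mod_cast hj2.le) hy)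
  refine le_trans (mul_le_mul_of_nonneg_right ?_ hk.le) this
  rw [← pow_mul, mul_comm γ, pow_mul]
  refine pow_le_pow_left₀ (by positivity) ?_ γ
  have hj3 : (2 : ℝ) ^ j * s ≤ r := by exact_mod_cast hj1
  have hr0 : (0 : ℝ) < r := by exact_mod_cast hr
  rw [one_div_pow, div_le_div_iff₀ (by positivity) (by positivity), pow_succ]
  linarith

end IsConductance

/-! ### The Harnack inequality on cubes -/

namespace IsConductance

variable {d : ℕ} {C : ZLat d → ZLat d → ℝ} {K δ M : ℝ} {N : ℕ}

open ZLat IsDiffusive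

/-- If a nonnegative harmonic function is at most `b` on at least a third of a cube of radius `s`,
then the jumps that leave a larger set `W` contribute at most `O(b / s²)`: this contribution acts
as a source, and the equation is tested with `ψ² / (h + b)`. -/
theorem exists_farSum_le (h1 : A1 C) (hC : IsConductance C) (hD : IsDiffusive C K δ M N) :
    ∃ G : ℝ, 0 ≤ G ∧ ∀ (x : ZLat d) (s : ℕ), 0 < s → ∀ (W : Finset (ZLat d)) (h : ZLat d → ℝ),
      (∀ z, 0 ≤ h z) → box x (3 * s) ⊆ W → HarmonicOn C h (box x (2 * s)) →
      ∀ b a : ℝ, 0 < b → 0 ≤ a → (∀ z ∈ box x (2 * s), a ≤ farSum C W h z) →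
      (box x s).card ≤ 3 * ((box x s).filter fun y => h y ≤ b).card →
      a ≤ G * b / s ^ 2 := by
  classical
  have hK := hD.moment_nonneg
  refine ⟨12 * 4 ^ d * K, by positivity, fun x s hs W h hh0 hW hh b a hb ha hfar hcard => ?_⟩
  have hs0 : (0 : ℝ) < s := by exact_mod_cast hs
  set S := box x (2 * s) with hS
  have hSW : S ⊆ W := (box_subset_box (by omega) (by
    rw [dist_self]; push_cast; linarith)).trans hW
  set t : ℝ := 1 / s with ht
  have ht0 : 0 ≤ t := by positivity
  set ψ := cutoff x ((2 * s : ℕ) : ℝ) t with hψ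
  set U : ZLat d → ℝ := fun z => h z + b with hU
  have hU0 : ∀ z, b ≤ U z := fun z => by simp only [hU]; linarith [hh0 z]
  have hlog := hD.sum_div_add_sum_log_le hSW (Finset.empty_subset W) (ψ := ψ) (U := U) (s := t)
    (fun z hz => cutoff_eq_zero ht0 (by
      by_contra hcon
      exact hz ((mem_box (by omega)).2 (not_le.1 hcon))))
    (fun z hz => by simp at hz) (abs_cutoff_sub_le x ht0) (fun z _ => hb.trans_le (hU0 z))
  rw [Finset.sum_empty, add_zero] at hlog
  set D := (box x s).filter fun y => h y ≤ b with hDdef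
  have hDS : D ⊆ S := (Finset.filter_subset _ _).trans (box_subset_box hs (by
    rw [dist_self]; push_cast; linarith))
  have hts : t ^ 2 = 1 / s ^ 2 := by rw [ht, one_div_pow]
  have hlow : ∑ z ∈ S, ψ z ^ 2 / U z * a - K / s ^ 2 * S.card ≤
      ∑ z ∈ S, ψ z ^ 2 / U z * ∑ y ∈ W, C z y * (U z - U y) := by
    rw [mul_comm _ (S.card : ℝ), ← nsmul_eq_mul, ← Finset.sum_const, ← Finset.sum_sub_distrib]
    refine Finset.sum_le_sum fun z hz => ?_
    have hUz := hb.trans_le (hU0 z)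
    have e1 : ∑ y ∈ W, C z y * (U z - U y) = ∑ y ∈ W, C z y * (h z - h y) :=
      Finset.sum_congr rfl fun y _ => by simp only [hU]; ring
    have hκ : farSum C W (fun _ => 1) z ≤ K / s ^ 2 := by
      refine farSum_one_le hD hs ((box_subset_box hs ?_).trans hW)
      rw [hS, mem_box (by omega)] at hz
      push_cast at hz ⊢
      linarith
    rw [e1, hh.sum_mul_sub h1 (Finset.mem_coe.2 hz) W, mul_sub]
    have h2 : ψ z ^ 2 ≤ 1 := pow_le_one₀ (cutoff_nonneg _ _ _ _) (cutoff_le_one _ _ _ _)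
    have h3 : 0 ≤ ψ z ^ 2 / U z := by positivity
    have h4 : ψ z ^ 2 / U z * a ≤ ψ z ^ 2 / U z * farSum C W h z :=
      mul_le_mul_of_nonneg_left (hfar z hz) h3
    have h5 : ψ z ^ 2 / U z * (farSum C W (fun _ => 1) z * h z) ≤ K / s ^ 2 := by
      have h6 : ψ z ^ 2 / U z * h z ≤ 1 := by
        rw [div_mul_eq_mul_div, div_le_one hUz]
        have : ψ z ^ 2 * h z ≤ 1 * h z := mul_le_mul_of_nonneg_right h2 (hh0 z)
        simp only [hU]; linarith
      have h7 := farSum_nonneg hC W (h := fun _ => 1) (fun _ => zero_le_one) z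
      calc _ = farSum C W (fun _ => 1) z * (ψ z ^ 2 / U z * h z) := by ring
        _ ≤ farSum C W (fun _ => 1) z * 1 := mul_le_mul_of_nonneg_left h6 h7
        _ ≤ _ := by rwa [mul_one]
    linarith
  have hDlow : (D.card : ℝ) * (a / (2 * b)) ≤ ∑ z ∈ S, ψ z ^ 2 / U z * a := by
    rw [← nsmul_eq_mul, ← Finset.sum_const]
    refine (Finset.sum_le_sum fun z hz => ?_).trans
      (Finset.sum_le_sum_of_subset_of_nonneg hDS fun z _ _ => ?_)
    · have hz' := Finset.mem_filter.1 hz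
      have h2 : ψ z = 1 := cutoff_eq_one (by
        have := (mem_box hs).1 hz'.1
        push_cast
        rw [ht, one_div, ← div_eq_inv_mul, one_le_div hs0]
        linarith)
      rw [h2, one_pow, one_div, ← div_eq_inv_mul]
      refine div_le_div_of_nonneg_left ha (hb.trans_le (hU0 z)) ?_
      simp only [hU]; linarith [hz'.2]
    · have := hb.trans_le (hU0 z)
      positivity
  have hcS : (S.card : ℝ) ≤ 4 ^ d * s ^ d := by
    refine (card_box_le x (by omega)).trans (le_of_eq ?_)
    rw [← mul_pow]; push_cast; ring
  have hcD : (s : ℝ) ^ d ≤ 3 * D.card :=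
    (pow_le_card_box x hs).trans (by exact_mod_cast hcard)
  rw [hts] at hlog
  have h8 : (D.card : ℝ) * (a / (2 * b)) ≤ 2 * (K / s ^ 2) * S.card := by
    have : 2 * (1 / (s : ℝ) ^ 2) * K * S.card = 2 * (K / s ^ 2 * S.card) := by ring
    linarith
  have h9 : (s : ℝ) ^ d * (a / (2 * b)) ≤ s ^ d * (6 * 4 ^ d * (K / s ^ 2)) := by
    calc (s : ℝ) ^ d * (a / (2 * b)) ≤ 3 * D.card * (a / (2 * b)) := by gcongr
      _ = 3 * (D.card * (a / (2 * b))) := by ring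
      _ ≤ 3 * (2 * (K / s ^ 2) * S.card) := by gcongr
      _ ≤ 3 * (2 * (K / s ^ 2) * (4 ^ d * s ^ d)) := by gcongr
      _ = _ := by ring
  have h10 := le_of_mul_le_mul_left h9 (by positivity)
  rw [div_le_iff₀ (by positivity)] at h10
  calc a ≤ _ := h10
    _ = _ := by ring

/-- If a nonnegative harmonic function does not exceed `(1 + ρ) h(x)` on a large cube around `x`,
then it is comparable to `h(x)` on a third of a smaller cube. Otherwise the growth lemma, applied
to `(1 + ρ) h(x) - h` inside the large cube, would make `h(x)` smaller than itself;
by (A4) the long jumps from different points contribute comparable amounts, and they are small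
because `h` is small somewhere. -/
theorem exists_card_le_of_le (h1 : A1 C) (hC : IsConductance C) (h4 : A4 C)
    (hD : IsDiffusive C K δ M N) (hd : 0 < d) :
    ∃ (m : ℕ) (β ρ : ℝ), 0 < m ∧ 0 < β ∧ β ≤ 1 ∧ 0 < ρ ∧ ∀ (x : ZLat d) (s : ℕ), 0 < s →
      ∀ h : ZLat d → ℝ, (∀ z, 0 ≤ h z) → HarmonicOn C h (box x (m * s)) → 0 < h x →
      (∀ y ∈ box x (m * s), h y ≤ (1 + ρ) * h x) →
      (box x s).card ≤ 3 * ((box x s).filter fun y => β * h x ≤ h y).card := by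
  classical
  obtain ⟨Λ, c, ε, hΛ, hc, hε, hgrow⟩ := hD.exists_growth hd
  obtain ⟨G, hG0, hG⟩ := exists_farSum_le h1 hC hD
  obtain ⟨c₄, hc₄, hA4⟩ := h4
  set H : ℝ := c₄ * (c₄ * G) with hH
  have hH0 : 0 ≤ H := by positivity
  set β : ℝ := min (1 / 2) (ε / (2 * (H + 1))) with hβ
  have hβ0 : 0 < β := lt_min (by norm_num) (by positivity)
  have hβ1 : β ≤ 1 / 2 := min_le_left _ _
  have hβ2 : 2 * H * β ≤ ε := by
    have h2 : β ≤ ε / (2 * (H + 1)) := min_le_right _ _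
    rw [le_div_iff₀ (by positivity)] at h2
    linarith
  refine ⟨Λ * (6 * d + 1), β, c / 4, Nat.mul_pos (by omega) (by omega), hβ0, by linarith,
    by positivity, fun x s hs h hh0 hh hx hle => ?_⟩
  set m := Λ * (6 * d + 1) with hm
  have hs0 : (0 : ℝ) < s := by exact_mod_cast hs
  have hm3 : 3 ≤ m := by nlinarith
  have hΛm : Λ ≤ m := Nat.le_mul_of_pos_right _ (by omega)
  have hms : 0 < m * s := Nat.mul_pos (by omega) hs
  have hΛs : 0 < Λ * s := Nat.mul_pos (by omega) hs
  have hsub : ∀ n, 0 < n → n ≤ m → box x (n * s) ⊆ box x (m * s) := fun n hn hnm =>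
    box_subset_box (Nat.mul_pos hn hs) (by
      rw [dist_self, zero_add]; exact_mod_cast Nat.mul_le_mul_right s hnm)
  by_contra hcon
  have hsplit := Finset.card_filter_add_card_filter_not (s := box x s) (fun y => β * h x ≤ h y)
  set W := box x (m * s) with hW
  have hDcard : (box x s).card ≤ 3 * ((box x s).filter fun y => h y ≤ β * h x).card := by
    have h2 : ((box x s).filter fun y => ¬ β * h x ≤ h y).card ≤
        ((box x s).filter fun y => h y ≤ β * h x).card :=
      Finset.card_le_card (Finset.monotone_filter_right _ fun y _ hy => (not_le.1 hy).le)
    omega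
  have hcomp : ∀ w ∈ box x (Λ * s), ∀ w' ∈ box x (Λ * s),
      farSum C W h w ≤ c₄ * farSum C W h w' := by
    intro w hw w' hw'
    refine farSum_le hC h1 hA4 hh0 hh (Finset.mem_coe.2 (hsub Λ (by omega) hΛm hw))
      (Finset.mem_coe.2 (hsub Λ (by omega) hΛm hw')) fun y hy => ?_
    rw [mem_box hΛs] at hw hw'
    rw [hW, mem_box hms, not_lt] at hy
    push_cast [hm] at hw hw' hy
    have e1 : dist w w' ≤ 2 * (Λ * s) := by
      linarith [dist_triangle_right w w' x]
    have e2 : 6 * (d : ℝ) * (Λ * s) ≤ dist y w := by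
      have := dist_triangle y w x
      linarith
    have e3 := eDist_le_mul_dist w w'
    have e4 := dist_le_eDist y w
    have e5 : (d : ℝ) * dist w w' ≤ d * (2 * (Λ * s)) := by gcongr
    linarith
  have hxΛ : x ∈ box x (Λ * s) := self_mem_box x hΛs
  have hfx := farSum_nonneg hC W hh0 x
  have h2s : ∀ z ∈ box x (2 * s), z ∈ box x (Λ * s) := fun z hz =>
    box_subset_box (by omega) (by
      rw [dist_self, zero_add]; exact_mod_cast Nat.mul_le_mul_right s hΛ) hz
  have hfar : farSum C W h x / c₄ ≤ G * (β * h x) / s ^ 2 := by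
    refine hG x s hs W h hh0 (hsub 3 (by norm_num) hm3)
      (fun z hz => hh z (Finset.mem_coe.2 (hsub 2 (by norm_num) (by omega) (Finset.mem_coe.1 hz))))
      (β * h x) _ (by positivity) (by positivity) (fun z hz => ?_) hDcard
    rw [div_le_iff₀' hc₄]
    exact hcomp x hxΛ z (h2s z hz)
  have hfar' : ∀ w ∈ box x (Λ * s), farSum C W h w ≤ H * β / s ^ 2 * h x := by
    intro w hw
    rw [div_le_iff₀ hc₄] at hfar
    calc farSum C W h w ≤ c₄ * farSum C W h x := hcomp w hw x hxΛ
      _ ≤ c₄ * (G * (β * h x) / s ^ 2 * c₄) := by gcongr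
      _ = _ := by rw [hH]; ring
  -- `v ≥ 1` where `h ≤ β h(x)`, whereas `v(x) = (c / 4) / q < c`.
  set q : ℝ := 1 + c / 4 - β with hq
  have hq0 : 1 / 2 ≤ q := by linarith
  have hqpos : 0 < q := by linarith
  set v : ZLat d → ℝ := fun y => (1 + c / 4 - h y / h x) / q with hv
  have hmain := hgrow x s hs W v (hsub Λ (by omega) hΛm)
    (fun y hy => by
      refine div_nonneg ?_ hqpos.le
      rw [sub_nonneg, div_le_iff₀ hx]
      exact hle y hy)
    (fun w hw => by
      have e1 : ∑ y ∈ W, C w y * (v w - v y) =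
          -((∑ y ∈ W, C w y * (h w - h y)) / (h x * q)) := by
        rw [Finset.sum_div, ← Finset.sum_neg_distrib]
        refine Finset.sum_congr rfl fun y _ => ?_
        simp only [hv]
        field_simp
        ring
      rw [e1, hh.sum_mul_sub h1 (Finset.mem_coe.2 (hsub Λ (by omega) hΛm hw)) W, neg_le_neg_iff,
        div_le_iff₀ (by positivity)]
      have e2 := hfar' w hw
      have e3 : 0 ≤ farSum C W (fun _ => 1) w * h w :=
        mul_nonneg (farSum_nonneg hC W (fun _ => zero_le_one) w) (hh0 w)
      have e4 : H * β ≤ ε * q := by nlinarith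
      calc _ ≤ H * β / s ^ 2 * h x := by linarith
        _ ≤ ε * q / s ^ 2 * h x := by gcongr
        _ = _ := by ring)
    (by
      refine hDcard.trans (Nat.mul_le_mul_left 3 (Finset.card_le_card
        (Finset.monotone_filter_right _ fun y _ hy => ?_)))
      have hy' : h y ≤ β * h x := hy
      have e1 : h y / h x ≤ β := by rwa [div_le_iff₀ hx]
      show 1 ≤ (1 + c / 4 - h y / h x) / q
      rw [one_le_div hqpos]
      linarith)
    x (self_mem_box x (by omega))
  simp only [hv, div_self hx.ne'] at hmain
  rw [le_div_iff₀ hqpos] at hmain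
  nlinarith

/-- The elliptic Harnack inequality on cubes, with a large ratio of radii. The comparison is made
at a maximum point of `h(x) d(x)^γ`, where `d(x) = 2r - |x - x₀|` and `γ` is the exponent of the
expansion of positivity: near such a point `h` cannot grow, so that it is large on a third of
a cube of radius comparable to `d(x)`. -/
theorem exists_box_harnack (h1 : A1 C) (hC : IsConductance C) (h4 : A4 C)
    (hD : IsDiffusive C K δ M N) (hd : 0 < d) :
    ∃ (Λ : ℕ) (c : ℝ), 0 < Λ ∧ 0 < c ∧ ∀ (x₀ : ZLat d) (r : ℕ), 0 < r → ∀ h : ZLat d → ℝ,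
      (∀ z, 0 ≤ h z) → HarmonicOn C h (box x₀ (Λ * r)) →
      ∀ x ∈ box x₀ r, ∀ y ∈ box x₀ r, h x ≤ c * h y := by
  classical
  obtain ⟨Λ, γ, hΛ, hexp⟩ := exists_expansion h1 hC hD hd
  obtain ⟨m, β, ρ, hm, hβ0, hβ1, hρ, hstep⟩ := exists_card_le_of_le h1 hC h4 hD hd
  -- On the cube of radius `σ w x₁` around the maximum point `x₁`, the weight `w ^ γ` varies by
  -- a factor of at most `1 + ρ`.
  set σ : ℝ := ρ / ((1 + ρ) * (γ + 1)) with hσ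
  have hσ0 : 0 < σ := by positivity
  have hσ1 : σ < 1 := by
    rw [hσ, div_lt_one (by positivity)]
    nlinarith [Nat.cast_nonneg (α := ℝ) γ]
  have hbern : 1 ≤ (1 + ρ) * (1 - σ) ^ γ := by
    have e1 := one_add_mul_le_pow (show (-2 : ℝ) ≤ -σ by linarith) γ
    have e2 : (γ : ℝ) * σ ≤ ρ / (1 + ρ) := by
      rw [hσ, ← mul_div_assoc, div_le_div_iff₀ (by positivity) (by positivity)]
      nlinarith [mul_pos hρ (show 0 < 1 + ρ by linarith)]
    have e3 : 1 - ρ / (1 + ρ) = 1 / (1 + ρ) := by field_simp; ring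
    have e4 : 1 / (1 + ρ) ≤ (1 - σ) ^ γ := by
      rw [← e3]
      calc 1 - ρ / (1 + ρ) ≤ 1 + γ * -σ := by linarith
        _ ≤ (1 + -σ) ^ γ := e1
        _ = _ := by ring
    rwa [div_le_iff₀' (by positivity)] at e4
  have hm0 : (0 : ℝ) < m := by exact_mod_cast hm
  have hm1 : (1 : ℝ) ≤ m := by exact_mod_cast hm
  set q : ℝ := (σ / (12 * m)) ^ γ * β with hq
  have hq0 : 0 < q := by positivity
  refine ⟨3 * Λ + 2, 1 / q, by omega, by positivity, fun x₀ r hr h hh0 hh x hx y hy => ?_⟩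
  have hr0 : (0 : ℝ) < r := by exact_mod_cast hr
  set w : ZLat d → ℝ := fun z => 2 * r - dist z x₀ with hw
  obtain ⟨x₁, hx₁, hmax⟩ := Finset.exists_max_image (box x₀ (2 * r)) (fun z => h z * w z ^ γ)
    ⟨x₀, self_mem_box x₀ (by omega)⟩
  have hx₁' : dist x₁ x₀ < 2 * r := by
    have := (mem_box (by omega)).1 hx₁
    exact_mod_cast this
  have hw1 : 0 < w x₁ := sub_pos.2 hx₁'
  have hw2 : w x₁ ≤ 2 * r := by simp only [hw]; linarith [dist_nonneg (x := x₁) (y := x₀)]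
  have hxr := (mem_box hr).1 hx
  have hyr := (mem_box hr).1 hy
  have hbox : ∀ z, dist z x₀ < 2 * r → z ∈ box x₀ (2 * r) := fun z hz =>
    (mem_box (by omega)).2 (by exact_mod_cast hz)
  have hxle : h x * r ^ γ ≤ h x₁ * w x₁ ^ γ := by
    refine le_trans ?_ (hmax x (hbox x (by linarith)))
    refine mul_le_mul_of_nonneg_left (pow_le_pow_left₀ hr0.le ?_ γ) (hh0 x)
    simp only [hw]; linarith
  rw [one_div, ← div_eq_inv_mul, le_div_iff₀ hq0]
  rcases (hh0 x₁).eq_or_lt with h0 | hpos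
  · rw [← h0, zero_mul] at hxle
    have e1 : h x ≤ 0 := by
      by_contra hcon
      exact absurd hxle (not_le.2 (mul_pos (not_le.1 hcon) (by positivity)))
    have e2 : h x = 0 := le_antisymm e1 (hh0 x)
    rw [e2, zero_mul]
    exact hh0 y
  obtain ⟨s, hs, hs1, hs2, hcard⟩ : ∃ s : ℕ, 0 < s ∧ s ≤ 3 * r ∧ σ * w x₁ / (2 * m) ≤ s ∧
      (box x₁ s).card ≤ 3 * ((box x₁ s).filter fun z => β * h x₁ ≤ h z).card := by
    -- If `w x₁` is of order one, the single point `x₁` is a cube on which `h` is large.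
    rcases lt_or_ge (σ * w x₁ / m) 1 with hlt | hge
    · refine ⟨1, one_pos, by omega, ?_, ?_⟩
      · have : σ * w x₁ / (2 * m) = σ * w x₁ / m / 2 := by field_simp
        rw [this]; push_cast; linarith
      · rw [card_box x₁ one_pos]
        have : 0 < ((box x₁ 1).filter fun z => β * h x₁ ≤ h z).card :=
          Finset.card_pos.2 ⟨x₁, Finset.mem_filter.2 ⟨self_mem_box x₁ one_pos,
            mul_le_of_le_one_left hpos.le hβ1⟩⟩
        simp only [mul_one, Nat.add_one_sub_one, one_pow]
        omega
    · set s := ⌊σ * w x₁ / m⌋₊ with hsdef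
      have hsp : 0 < s := Nat.floor_pos.2 hge
      have hsle : (s : ℝ) ≤ σ * w x₁ / m := Nat.floor_le (by positivity)
      have hsge : σ * w x₁ / m < s + 1 := Nat.lt_floor_add_one _
      have hs1' : (1 : ℝ) ≤ s := by exact_mod_cast hsp
      have hmsle : (m : ℝ) * s ≤ σ * w x₁ := by rwa [le_div_iff₀' hm0] at hsle
      have hms : 0 < m * s := Nat.mul_pos hm hsp
      have hwz : ∀ z ∈ box x₁ (m * s), (1 - σ) * w x₁ ≤ w z := by
        intro z hz
        rw [mem_box hms] at hz
        push_cast at hz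
        have := dist_triangle z x₁ x₀
        simp only [hw] at hmsle ⊢
        linarith
      have hzbox : ∀ z ∈ box x₁ (m * s), z ∈ box x₀ (2 * r) := by
        intro z hz
        have e1 := hwz z hz
        have e2 : 0 < (1 - σ) * w x₁ := mul_pos (by linarith) hw1
        refine hbox z ?_
        have e3 : 0 < w z := e2.trans_le e1
        simp only [hw] at e3
        linarith
      refine ⟨s, hsp, ?_, ?_, hstep x₁ s hsp h hh0 (fun z hz => hh z ?_) hpos fun z hz => ?_⟩
      · have e1 : (s : ℝ) ≤ 3 * r := by
          nlinarith
        exact_mod_cast e1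
      · have : σ * w x₁ / (2 * m) = σ * w x₁ / m / 2 := by field_simp
        rw [this]; linarith
      · refine Finset.mem_coe.2 (box_subset_box (by omega) ?_ (hzbox z (Finset.mem_coe.1 hz)))
        rw [dist_self]; push_cast
        have : (0 : ℝ) ≤ Λ * r := by positivity
        linarith
      · have e1 := hmax z (hzbox z hz)
        have e2 : 0 ≤ (1 - σ) * w x₁ := mul_nonneg (by linarith) hw1.le
        have e3 : h z * ((1 - σ) * w x₁) ^ γ ≤ h x₁ * w x₁ ^ γ :=
          le_trans (mul_le_mul_of_nonneg_left (pow_le_pow_left₀ e2 (hwz z hz) γ) (hh0 z)) e1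
        rw [mul_pow, ← mul_assoc] at e3
        have e4 : h z * (1 - σ) ^ γ ≤ h x₁ := le_of_mul_le_mul_right e3 (by positivity)
        calc h z ≤ h z * ((1 + ρ) * (1 - σ) ^ γ) := le_mul_of_one_le_right (hh0 z) hbern
          _ = (1 + ρ) * (h z * (1 - σ) ^ γ) := by ring
          _ ≤ _ := by gcongr
  have hys := hexp x₁ s (3 * r) hs hs1 h hh0
    (fun z hz => hh z (Finset.mem_coe.2 (box_subset_box (by positivity) (by
      push_cast; linarith) (Finset.mem_coe.1 hz))))
    (β * h x₁) (by positivity) hcard y ((mem_box (by omega)).2 (by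
      push_cast
      linarith [dist_triangle_right y x₁ x₀]))
  refine le_trans ?_ hys
  have e1 : σ / (12 * m) * (w x₁ / r) ≤ s / (2 * (3 * r : ℕ)) := by
    push_cast
    have : σ / (12 * m) * (w x₁ / r) = σ * w x₁ / (2 * m) / (2 * (3 * r)) := by field_simp; norm_num
    rw [this]
    gcongr
  have e2 : h x ≤ (w x₁ / r) ^ γ * h x₁ := by
    rw [div_pow, div_mul_eq_mul_div, le_div_iff₀ (by positivity)]
    linarith
  calc h x * q ≤ (w x₁ / r) ^ γ * h x₁ * q := by gcongr
    _ = (σ / (12 * m) * (w x₁ / r)) ^ γ * (β * h x₁) := by rw [hq, mul_pow]; ring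
    _ ≤ _ := by gcongr

end IsConductance

/-! ### The Harnack inequality on Euclidean balls -/

theorem le_pow_mul_of_hop {g : ℕ → ℝ} {c : ℝ} (hc : 0 ≤ c) {n t : ℕ}
    (h : ∀ a b, a ≤ n → b ≤ n → a ≤ b → b ≤ a + t → g a ≤ c * g b ∧ g b ≤ c * g a) {k : ℕ}
    (hk : n ≤ k * t) : g 0 ≤ c ^ k * g n ∧ g n ≤ c ^ k * g 0 := by
  have key : ∀ k : ℕ, g 0 ≤ c ^ k * g (min (k * t) n) ∧ g (min (k * t) n) ≤ c ^ k * g 0 := by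
    intro k
    induction k with
    | zero => simp
    | succ k ih =>
      have hs : (k + 1) * t = k * t + t := by ring
      have h2 := h (min (k * t) n) (min ((k + 1) * t) n) (min_le_right _ _) (min_le_right _ _)
        (by rw [hs]; omega) (by rw [hs]; omega)
      constructor
      · calc g 0 ≤ c ^ k * g (min (k * t) n) := ih.1
          _ ≤ c ^ k * (c * g (min ((k + 1) * t) n)) := by gcongr; exact h2.1
          _ = _ := by ring
      · calc g (min ((k + 1) * t) n) ≤ c * g (min (k * t) n) := h2.2
          _ ≤ c * (c ^ k * g 0) := by gcongr; exact ih.2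
          _ = _ := by ring
  have := key k
  rwa [min_eq_right hk] at this

namespace IsConductance

variable {d : ℕ} {C : ZLat d → ZLat d → ℝ} {K δ M : ℝ} {N : ℕ}

open ZLat

theorem exists_path_in_eBall {x₀ x : ZLat d} {R : ℝ} (hx : x ∈ eBall x₀ R) :
    ∃ (n : ℕ) (p : ℕ → ZLat d), (n : ℝ) ≤ d * R ∧ p 0 = x₀ ∧ p n = x ∧
      (∀ k, p k ∈ eBall x₀ R) ∧ ∀ k < n, eDist (p k) (p (k + 1)) = 1 := by
  obtain ⟨p, hp0, hpn, hp1, hp2⟩ := exists_monotone_path (x - x₀)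
  have hx' : eDist x₀ x < R := hx
  refine ⟨length (x - x₀), fun k => x₀ + p k, ?_, by simp [hp0], by simp [hpn], ?_, ?_⟩
  · refine (length_le _).trans ?_
    have h1 : dist (x - x₀) 0 = dist x₀ x := by rw [dist_comm]; simp [dist_eq_norm]
    have h2 := dist_le_eDist x₀ x
    have h3 : dist (x - x₀) 0 ≤ R := by linarith
    gcongr
  · intro k
    refine lt_of_le_of_lt (eDist_le_of_forall_abs_le fun i => ?_) hx'
    have := hp2 k i
    simpa [abs_sub_comm] using this
  · intro k hk
    rw [eDist_add_left]
    exact hp1 k hk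

/-- On large balls, the Harnack inequality on cubes is chained along a lattice path to the centre. -/
theorem exists_harnack_of_large (h1 : A1 C) (hC : IsConductance C) (h4 : A4 C)
    (hD : IsDiffusive C K δ M N) (hd : 0 < d) :
    ∃ (R₁ c : ℝ), 0 ≤ c ∧ ∀ (x₀ : ZLat d) (R : ℝ), R₁ ≤ R → ∀ h : ZLat d → ℝ,
      (∀ z, 0 ≤ h z) → HarmonicOn C h (eBall x₀ (2 * R)) →
      ∀ x ∈ eBall x₀ R, h x₀ ≤ c * h x ∧ h x ≤ c * h x₀ := by
  obtain ⟨Λ, c, hΛ, hc, hbox⟩ := exists_box_harnack h1 hC h4 hD hd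
  have hd0 : (0 : ℝ) < d := by exact_mod_cast hd
  have hΛ0 : (0 : ℝ) < Λ := by exact_mod_cast hΛ
  refine ⟨2 * (d * Λ), c ^ (3 * d * (d * Λ)), by positivity,
    fun x₀ R hR h hh0 hh x hx => ?_⟩
  have hD0 : (0 : ℝ) < d * Λ := by positivity
  have hR0 : 0 < R := by linarith
  set r := ⌊R / (d * Λ)⌋₊ with hr
  have hr2 : 2 ≤ r := Nat.le_floor (by rw [le_div_iff₀ hD0]; exact_mod_cast hR)
  have hr3 : d * Λ * (r : ℝ) ≤ R := by
    have := Nat.floor_le (show 0 ≤ R / (d * Λ) by positivity)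
    rwa [le_div_iff₀' hD0] at this
  have hr4 : R < d * Λ * (r + 1) := by
    have := Nat.lt_floor_add_one (R / (d * Λ))
    rwa [div_lt_iff₀' hD0] at this
  have hr0 : 0 < r := by omega
  obtain ⟨n, p, hn, hp0, hpn, hpR, hp1⟩ := exists_path_in_eBall hx
  have hhop := le_pow_mul_of_hop (g := fun a => h (p a)) hc.le (n := n) (t := r - 1)
    (fun a b ha hb hab hbt => by
      have hdist : dist (p b) (p a) < r := by
        have e1 : dist (p a) (p b) ≤ ∑ i ∈ Finset.Ico a b, (1 : ℝ) :=
          dist_le_Ico_sum_of_dist_le hab fun {k} _ hkb =>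
            (dist_le_eDist _ _).trans (hp1 k (by omega)).le
        rw [Finset.sum_const, Nat.card_Ico, nsmul_eq_mul, mul_one] at e1
        rw [dist_comm]
        refine e1.trans_lt ?_
        exact_mod_cast (by omega : b - a < r)
      have hharm : HarmonicOn C h (box (p a) (Λ * r)) := by
        intro z hz
        refine hh z ?_
        have hz' := (mem_box (Nat.mul_pos hΛ hr0)).1 (Finset.mem_coe.1 hz)
        rw [dist_comm] at hz'
        push_cast at hz'
        have e1 := eDist_le_mul_dist (p a) z
        have e2 : (d : ℝ) * dist (p a) z ≤ d * (Λ * r) := by gcongr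
        have e3 := eDist_triangle x₀ (p a) z
        have e4 : eDist x₀ (p a) < R := hpR a
        show eDist x₀ z < 2 * R
        linarith
      have ha' := self_mem_box (p a) hr0
      have hb' := (mem_box hr0).2 hdist
      exact ⟨hbox _ r hr0 h hh0 hharm _ ha' _ hb', hbox _ r hr0 h hh0 hharm _ hb' _ ha'⟩)
    (k := 3 * d * (d * Λ)) (by
      have e1 : (n : ℝ) ≤ (3 * d * (d * Λ) : ℕ) * ((r - 1 : ℕ) : ℝ) := by
        rw [Nat.cast_sub (by omega)]
        push_cast
        have e2 : (2 : ℝ) ≤ r := by exact_mod_cast hr2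
        calc (n : ℝ) ≤ d * R := hn
          _ ≤ d * (d * Λ * (3 * (r - 1))) := by
              refine mul_le_mul_of_nonneg_left (hr4.le.trans ?_) hd0.le
              exact mul_le_mul_of_nonneg_left (by linarith) hD0.le
          _ = _ := by ring
      exact_mod_cast e1)
  simpa only [hp0, hpn] using hhop

/-- On balls of bounded radius, the paths of (A2) suffice. -/
theorem exists_harnack_of_le (h1 : A1 C) (hC : IsConductance C) (hD : IsDiffusive C K δ M N)
    (R₁ : ℝ) :
    ∃ c : ℝ, 0 ≤ c ∧ ∀ (x₀ : ZLat d) (R : ℝ), M < R → R ≤ R₁ → ∀ h : ZLat d → ℝ,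
      (∀ z, 0 ≤ h z) → HarmonicOn C h (eBall x₀ (2 * R)) →
      ∀ x ∈ eBall x₀ R, h x₀ ≤ c * h x ∧ h x ≤ c * h x₀ := by
  obtain ⟨c₁, c₂, hc₁, hc₂, hν⟩ := id h1
  have hδ := hD.delta_pos
  set θ : ℝ := min 1 (δ / c₂) with hθ
  have hθ0 : 0 < θ := lt_min one_pos (by positivity)
  have hθ1 : θ ≤ 1 := min_le_left _ _
  obtain ⟨k, hk⟩ := exists_nat_gt (d * R₁)
  refine ⟨(1 / θ ^ N) ^ k, by positivity, fun x₀ R hMR hR h hh0 hh x hx => ?_⟩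
  have hedge : ∀ u ∈ eBall x₀ (2 * R), ∀ w, δ ≤ C u w → θ * h w ≤ h u := by
    intro u hu w huw
    have hs := hh.hasSum h1 hu
    have e1 : C u w * h w ≤ nu C u * h u :=
      le_hasSum hs w fun y _ => mul_nonneg (hC.nonneg u y) (hh0 y)
    have e2 : δ * h w ≤ c₂ * h u := by
      calc δ * h w ≤ C u w * h w := mul_le_mul_of_nonneg_right huw (hh0 w)
        _ ≤ nu C u * h u := e1
        _ ≤ c₂ * h u := mul_le_mul_of_nonneg_right (hν u).2.2 (hh0 u)
    calc θ * h w ≤ δ / c₂ * h w := mul_le_mul_of_nonneg_right (min_le_right _ _) (hh0 w)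
      _ = δ * h w / c₂ := by ring
      _ ≤ h u := by rwa [div_le_iff₀' hc₂]
  have hnbr : ∀ u ∈ eBall x₀ R, ∀ w, eDist u w = 1 → h w ≤ 1 / θ ^ N * h u := by
    intro u hu w huw
    obtain ⟨n, hn, p, hp0, hpn, hpM, hpC⟩ := hD.path u w huw
    have key : ∀ i ≤ n, θ ^ i * h (p i) ≤ h u := by
      intro i
      induction i with
      | zero => intro _; simp [hp0]
      | succ i ih =>
        intro hi
        have hpi : p i ∈ eBall x₀ (2 * R) := by
          have e1 := eDist_triangle x₀ u (p i)
          have e2 := hpM i (by omega)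
          have e3 : eDist x₀ u < R := hu
          show eDist x₀ (p i) < 2 * R
          linarith
        calc θ ^ (i + 1) * h (p (i + 1)) = θ ^ i * (θ * h (p (i + 1))) := by ring
          _ ≤ θ ^ i * h (p i) := by
              gcongr
              exact hedge _ hpi _ (hpC i (by omega))
          _ ≤ h u := ih (by omega)
    rw [one_div, ← div_eq_inv_mul, le_div_iff₀ (by positivity)]
    calc h w * θ ^ N ≤ h w * θ ^ n :=
          mul_le_mul_of_nonneg_left (pow_le_pow_of_le_one hθ0.le hθ1 hn) (hh0 w)
      _ = θ ^ n * h (p n) := by rw [hpn]; ring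
      _ ≤ h u := key n le_rfl
  obtain ⟨n, p, hn, hp0, hpn, hpR, hp1⟩ := exists_path_in_eBall hx
  have hone : 1 ≤ 1 / θ ^ N := by
    rw [one_le_div (by positivity)]
    exact pow_le_one₀ hθ0.le hθ1
  have hhop := le_pow_mul_of_hop (g := fun a => h (p a)) (c := 1 / θ ^ N) (by positivity)
    (n := n) (t := 1) (fun a b ha hb hab hbt => by
      rcases hab.eq_or_lt with rfl | hlt
      · have := le_mul_of_one_le_left (hh0 (p a)) hone
        exact ⟨this, this⟩
      · obtain rfl : b = a + 1 := by omega
        have e1 := hp1 a (by omega)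
        exact ⟨hnbr _ (hpR (a + 1)) _ (by rwa [eDist_comm]), hnbr _ (hpR a) _ e1⟩)
    (k := k) (by
      have e1 : (n : ℝ) ≤ k := by
        have : (d : ℝ) * R ≤ d * R₁ := by gcongr
        linarith
      rw [mul_one]
      exact_mod_cast e1)
  simpa only [hp0, hpn] using hhop

end IsConductance

theorem theorem5p3 (d : ℕ) (C : ZLat d → ZLat d → ℝ) (hC : IsConductance C) (M₀ : ℝ)
    (h1 : IsConductance.A1 C) (h2 : IsConductance.A2 C M₀)
    (h3 : IsConductance.A3 C) (h4 : IsConductance.A4 C) :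
    ∃ c : ℝ, 0 < c ∧ ∀ (x₀ : ZLat d) (R : ℝ), M₀ < R →
      ∀ h : ZLat d → ℝ, (∀ z, 0 ≤ h z) → (∃ B : ℝ, ∀ z, h z ≤ B) →
        IsConductance.HarmonicOn C h (ZLat.eBall x₀ (2 * R)) →
          ∀ x ∈ ZLat.eBall x₀ R, ∀ y ∈ ZLat.eBall x₀ R, h x ≤ c * h y := by
  rcases Nat.eq_zero_or_pos d with rfl | hd
  · exact ⟨1, one_pos, fun x₀ R _ h _ _ _ x _ y _ => by rw [Subsingleton.elim x y, one_mul]⟩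
  obtain ⟨K, δ, N, hD⟩ := IsConductance.exists_isDiffusive hC h2 h3 hd
  obtain ⟨R₁, a, ha, hlarge⟩ := IsConductance.exists_harnack_of_large h1 hC h4 hD hd
  obtain ⟨b, hb, hsmall⟩ := IsConductance.exists_harnack_of_le h1 hC hD R₁
  refine ⟨(a + b + 1) ^ 2, by positivity, fun x₀ R hR h hh0 _ hh => ?_⟩
  have key : ∀ x ∈ ZLat.eBall x₀ R,
      h x₀ ≤ (a + b + 1) * h x ∧ h x ≤ (a + b + 1) * h x₀ := by
    intro x hx
    have hx0 := hh0 x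
    have hx00 := hh0 x₀
    rcases le_total R₁ R with hRR | hRR
    · obtain ⟨e1, e2⟩ := hlarge x₀ R hRR h hh0 hh x hx
      exact ⟨e1.trans (by gcongr; linarith), e2.trans (by gcongr; linarith)⟩
    · obtain ⟨e1, e2⟩ := hsmall x₀ R hR hRR h hh0 hh x hx
      exact ⟨e1.trans (by gcongr; linarith), e2.trans (by gcongr; linarith)⟩
  intro x hx y hy
  calc h x ≤ (a + b + 1) * h x₀ := (key x hx).2
    _ ≤ (a + b + 1) * ((a + b + 1) * h y) := by
        gcongr
        exact (key y hy).1
    _ = _ := by ring
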